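/- Let $P=(P(i,j))_{i,j\in\mathbb N}$ be a Markov kernel on $\mathbb N$ (that is, $P(i,j)\ge 0$ and $\sum_{j}P(i,j)=1$ for every $i$), acting on functions by $(Pf)(i)=\sum_{j}P(i,j)f(j)$, and let $V:\mathbb N\to[1,+\infty)$ satisfy $$\lim_{n\to\infty}V(n)=+\infty\quad\text{and}\quad \sup_{n\in\mathbb N}\frac{(PV)(n)}{V(n)}<\infty .$$ Let $\mathcal B_V$ be the Banach space of functions $f:\mathbb N\to\mathbb C$ with $\|f\|_V:=\sup_{n}|f(n)|/V(n)<\infty$, on which $P$ acts as a bounded linear operator. Then the following two conditions are equivalent: (a) (weak drift condition) there exist an integer $N\ge 1$ and real numbers $d\in(0,+\infty)$, $\delta\in(0,1)$ such that $P^NV\le\delta^N V+d$ on $\mathbb N$; (b) $L:=\inf_{N\ge1}(\ell_N)^{1/N}<1$, where $\ell_N:=\limsup_{n\to+\infty}\dfrac{(P^NV)(n)}{V(n)}$. In this case, $P$ is power-bounded on $\mathcal B_V$ (that is, $\sup_{n\ge1}\|P^n\|_V<\infty$ for the operator norm) and quasi-compact on $\mathcal B_V$, and $$r_{ess}(P)=\delta_V(P)=L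 .$$ Here $$\delta_V(P):=\inf\{\delta\in[0,1):\exists N\ge1,\ \exists d\in(0,+\infty),\ P^NV\le\delta^NV+d\}.$$ For $r_0\in(0,1)$, let $(D_{r_0})$ be the property that there exist $m\ge1$, $\lambda_1,\dots,\lambda_m\in\mathbb C$, $p_1,\dots,p_m\ge1$ and a closed $P$-invariant subspace $H$ of $\mathcal B_V$ with $$\mathcal B_V=\bigoplus_{i=1}^m\ker(P-\lambda_iI)^{p_i}\oplus H,\qquad |\lambda_i|\ge r_0,\qquad 1\le\dim\ker(P-\lambda_iI)^{p_i}<\infty\quad(1\le i\le m),$$ $$\inf_{n\ge1}\Big(\sup_{h\in H,\ \|h\|_V\le1}\|P^nh\|_V\Big)^{1/n}<r_0 .$$ $P$ is quasi-compact on $\mathcal B_V$ if $(D_{r_0})$ holds for some $r_0\in(0,1)$, and then its essential spectral radius is $r_{ess}(P):=\inf\{r_0\in(0,1):(D_{r_0})\text{ holds}\}$. -/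

import Mathlib

open Filter Topology

noncomputable section

namespace MarkovBV

/-! ### Markov kernels on `ℕ` -/

/-- `P = (P(i,j))_{i,j}` is a Markov kernel on `ℕ`: nonnegative entries, rows summing to one. -/
def IsMarkov (P : ℕ → ℕ → ℝ) : Prop :=
  (∀ i j, 0 ≤ P i j) ∧ ∀ i, HasSum (P i) 1

/-- The action of a kernel on functions: `(P f)(i) = ∑_j P(i,j) f(j)`. -/
def act {E : Type*} [NormedAddCommGroup E] [NormedSpace ℝ E]
    (P : ℕ → ℕ → ℝ) (f : ℕ → E) : ℕ → E :=
  fun i => ∑' j, P i j • f j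

/-- The function `P^N V`. -/
def iterV (P : ℕ → ℕ → ℝ) (V : ℕ → Set.Ici (1 : ℝ)) (N : ℕ) : ℕ → ℝ :=
  (act P)^[N] (fun n => (V n : ℝ))

/-- `sup_n (P V)(n) / V(n) < ∞`. Since the sums are real-valued, the finiteness of each `(P V)(n)`
is stated separately. -/
def DriftBounded (P : ℕ → ℕ → ℝ) (V : ℕ → Set.Ici (1 : ℝ)) : Prop :=
  (∀ n, Summable fun j => P n j * (V j : ℝ)) ∧
    BddAbove (Set.range fun n => iterV P V 1 n / (V n : ℝ))

/-- The weak drift condition. -/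
def WeakDrift (P : ℕ → ℕ → ℝ) (V : ℕ → Set.Ici (1 : ℝ)) : Prop :=
  ∃ N : ℕ, 1 ≤ N ∧ ∃ d : ℝ, 0 < d ∧ ∃ δ : ℝ, 0 < δ ∧ δ < 1 ∧
    ∀ n, iterV P V N n ≤ δ ^ N * (V n : ℝ) + d

/-- `δ_V(P)`. -/
def deltaV (P : ℕ → ℕ → ℝ) (V : ℕ → Set.Ici (1 : ℝ)) : ℝ :=
  sInf {δ : ℝ | 0 ≤ δ ∧ δ < 1 ∧ ∃ N : ℕ, 1 ≤ N ∧ ∃ d : ℝ, 0 < d ∧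
    ∀ n, iterV P V N n ≤ δ ^ N * (V n : ℝ) + d}

/-- `ℓ_N = limsup_n (P^N V)(n) / V(n)`. -/
def ell (P : ℕ → ℕ → ℝ) (V : ℕ → Set.Ici (1 : ℝ)) (N : ℕ) : ℝ :=
  limsup (fun n => iterV P V N n / (V n : ℝ)) atTop

/-- `L = inf_{N ≥ 1} (ℓ_N)^{1/N}`. -/
def bigL (P : ℕ → ℕ → ℝ) (V : ℕ → Set.Ici (1 : ℝ)) : ℝ :=
  sInf {x : ℝ | ∃ N : ℕ, 1 ≤ N ∧ x = ell P V N ^ (1 / (N : ℝ))}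

/-! ### Quasi-compactness -/

section QuasiCompact

variable {E : Type*} [NormedAddCommGroup E] [NormedSpace ℂ E]

/-- `E = ⨁ᵢ ker (T - λᵢ)^{pᵢ} ⊕ H`, a finite nonempty sum with `|λᵢ| ≥ r₀` and
`1 ≤ dim ker (T - λᵢ)^{pᵢ} < ∞`, where `H` is closed and `T`-invariant and
`inf_{n ≥ 1} (sup_{h ∈ H, ‖h‖ ≤ 1} ‖Tⁿ h‖)^{1/n} < r₀`. -/
def QCDecomposition (T : E →L[ℂ] E) (r₀ : ℝ) : Prop :=
  ∃ (m : ℕ) (lam : Fin m → ℂ) (p : Fin m → ℕ) (H : Submodule ℂ E),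
    1 ≤ m ∧ (∀ i, 1 ≤ p i) ∧
    DirectSum.IsInternal (fun o : Option (Fin m) =>
      o.elim H (fun i => LinearMap.ker (((T : E →ₗ[ℂ] E) - lam i • LinearMap.id) ^ p i))) ∧
    (∀ i, r₀ ≤ ‖lam i‖) ∧
    (∀ i, FiniteDimensional ℂ
        (LinearMap.ker (((T : E →ₗ[ℂ] E) - lam i • LinearMap.id) ^ p i)) ∧
      1 ≤ Module.finrank ℂ
        (LinearMap.ker (((T : E →ₗ[ℂ] E) - lam i • LinearMap.id) ^ p i))) ∧
    IsClosed (H : Set E) ∧ (∀ h ∈ H, T h ∈ H) ∧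
    sInf {x : ℝ | ∃ n : ℕ, 1 ≤ n ∧
      x = (⨆ h : {h : E // h ∈ H ∧ ‖h‖ ≤ 1}, ‖(T ^ n) (h : E)‖) ^ (1 / (n : ℝ))} < r₀

/-- `T` is quasi-compact. -/
def QuasiCompact (T : E →L[ℂ] E) : Prop :=
  ∃ r₀ : ℝ, 0 < r₀ ∧ r₀ < 1 ∧ QCDecomposition T r₀

/-- The essential spectral radius of a quasi-compact operator `T`. -/
def essSpectralRadius (T : E →L[ℂ] E) : ℝ :=
  sInf {r₀ : ℝ | 0 < r₀ ∧ r₀ < 1 ∧ QCDecomposition T r₀}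

/-- `sup_{n ≥ 1} ‖Tⁿ‖ < ∞`. -/
def PowerBounded (T : E →L[ℂ] E) : Prop :=
  ∃ C : ℝ, ∀ n : ℕ, 1 ≤ n → ‖T ^ n‖ ≤ C

end QuasiCompact

/-! ### The weighted-supremum space -/

/-- The functions `f : ℕ → ℂ` with `sup_n |f(n)| / V(n) < ∞`, as a subspace of `ℕ → ℂ`. -/
def bvSubmodule (V : ℕ → Set.Ici (1 : ℝ)) : Submodule ℂ (ℕ → ℂ) where
  carrier := {f | BddAbove (Set.range fun n => ‖f n‖ / (V n : ℝ))}
  zero_mem' := ⟨0, by rintro _ ⟨n, rfl⟩; simp⟩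
  add_mem' := by
    rintro f g ⟨a, ha⟩ ⟨b, hb⟩
    refine ⟨a + b, ?_⟩
    rintro _ ⟨n, rfl⟩
    have hV : (0 : ℝ) < V n := lt_of_lt_of_le one_pos (V n).2
    have h1 := ha ⟨n, rfl⟩
    have h2 := hb ⟨n, rfl⟩
    calc ‖(f + g) n‖ / (V n : ℝ) ≤ (‖f n‖ + ‖g n‖) / (V n : ℝ) := by
          gcongr; exact norm_add_le _ _
      _ = ‖f n‖ / (V n : ℝ) + ‖g n‖ / (V n : ℝ) := add_div _ _ _
      _ ≤ a + b := add_le_add h1 h2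
  smul_mem' := by
    rintro c f ⟨a, ha⟩
    refine ⟨‖c‖ * a, ?_⟩
    rintro _ ⟨n, rfl⟩
    have h1 := ha ⟨n, rfl⟩
    calc ‖(c • f) n‖ / (V n : ℝ) = ‖c‖ * (‖f n‖ / (V n : ℝ)) := by
          simp [mul_div_assoc]
      _ ≤ ‖c‖ * a := mul_le_mul_of_nonneg_left h1 (norm_nonneg _)

/-- The weighted-supremum space `B_V`; a separate name for the type of elements of `bvSubmodule V`,
so that it carries the norm topology and not the topology of pointwise convergence. -/
def BV (V : ℕ → Set.Ici (1 : ℝ)) : Type := bvSubmodule V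

variable {V : ℕ → Set.Ici (1 : ℝ)}

instance : AddCommGroup (BV V) := inferInstanceAs (AddCommGroup (bvSubmodule V))

instance : Module ℂ (BV V) := inferInstanceAs (Module ℂ (bvSubmodule V))

/-- The function underlying an element of `B_V`. -/
def BV.toFun (f : BV V) : ℕ → ℂ := Subtype.val (p := fun g => g ∈ bvSubmodule V) f

/-- `‖f‖_V = sup_n |f(n)| / V(n)`. -/
instance : Norm (BV V) := ⟨fun f => ⨆ n, ‖f.toFun n‖ / (V n : ℝ)⟩

theorem BV.norm_def (f : BV V) : ‖f‖ = ⨆ n, ‖f.toFun n‖ / (V n : ℝ) := rfl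

theorem BV.bddAbove (f : BV V) : BddAbove (Set.range fun n => ‖f.toFun n‖ / (V n : ℝ)) :=
  Subtype.property (p := fun g => g ∈ bvSubmodule V) f

theorem BV.ext {f g : BV V} (h : ∀ n, f.toFun n = g.toFun n) : f = g :=
  Subtype.ext (funext h)

theorem BV.toFun_add (f g : BV V) (n : ℕ) : (f + g).toFun n = f.toFun n + g.toFun n := rfl

theorem BV.toFun_smul (c : ℂ) (f : BV V) (n : ℕ) : (c • f).toFun n = c * f.toFun n := rfl

theorem BV.toFun_zero (n : ℕ) : (0 : BV V).toFun n = 0 := rfl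

theorem V_pos (V : ℕ → Set.Ici (1 : ℝ)) (n : ℕ) : (0 : ℝ) < V n :=
  lt_of_lt_of_le one_pos (V n).2

theorem BV.norm_toFun_le (f : BV V) (n : ℕ) : ‖f.toFun n‖ ≤ ‖f‖ * (V n : ℝ) :=
  (div_le_iff₀ (V_pos V n)).1 (le_ciSup f.bddAbove n)

theorem BV.norm_le {f : BV V} {C : ℝ} (h : ∀ n, ‖f.toFun n‖ ≤ C * (V n : ℝ)) : ‖f‖ ≤ C :=
  ciSup_le fun n => (div_le_iff₀ (V_pos V n)).2 (h n)

theorem BV.core : NormedSpace.Core ℂ (BV V) where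
  norm_nonneg f := Real.iSup_nonneg fun n => div_nonneg (norm_nonneg _) (V_pos V n).le
  norm_smul c f := by
    simp only [BV.norm_def, BV.toFun_smul, norm_mul, mul_div_assoc]
    exact (Real.mul_iSup_of_nonneg (norm_nonneg c) _).symm
  norm_triangle f g := BV.norm_le fun n => by
    rw [add_mul, BV.toFun_add]
    exact (norm_add_le _ _).trans (add_le_add (f.norm_toFun_le n) (g.norm_toFun_le n))
  norm_eq_zero_iff f := by
    constructor
    · intro h
      refine BV.ext fun n => ?_
      have := f.norm_toFun_le n
      rw [h, zero_mul] at this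
      rw [BV.toFun_zero]
      exact norm_le_zero_iff.1 this
    · rintro rfl
      simp [BV.norm_def, BV.toFun_zero]

instance : NormedAddCommGroup (BV V) := NormedAddCommGroup.ofCore BV.core

instance : NormedSpace ℂ (BV V) := NormedSpace.ofCore BV.core

/-! ### The operator `P` on `B_V` -/

theorem summable_norm_act {P : ℕ → ℕ → ℝ} (hP : IsMarkov P) (hPV : DriftBounded P V)
    (f : BV V) (i : ℕ) : Summable fun j => ‖P i j • f.toFun j‖ := by
  refine Summable.of_nonneg_of_le (fun _ => norm_nonneg _) (fun j => ?_)
    ((hPV.1 i).mul_left ‖f‖)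
  rw [norm_smul, Real.norm_of_nonneg (hP.1 i j)]
  calc P i j * ‖f.toFun j‖ ≤ P i j * (‖f‖ * (V j : ℝ)) :=
        mul_le_mul_of_nonneg_left (f.norm_toFun_le j) (hP.1 i j)
    _ = ‖f‖ * (P i j * (V j : ℝ)) := by ring

theorem norm_act_le {P : ℕ → ℕ → ℝ} (hP : IsMarkov P) (hPV : DriftBounded P V)
    (f : BV V) (i : ℕ) : ‖act P f.toFun i‖ ≤
      (⨆ n, iterV P V 1 n / (V n : ℝ)) * ‖f‖ * (V i : ℝ) := by
  have h1 : iterV P V 1 i ≤ (⨆ n, iterV P V 1 n / (V n : ℝ)) * (V i : ℝ) :=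
    (div_le_iff₀ (V_pos V i)).1 (le_ciSup hPV.2 i)
  have h2 : ‖act P f.toFun i‖ ≤ ‖f‖ * iterV P V 1 i := by
    have h3 : iterV P V 1 i = ∑' j, P i j * (V j : ℝ) := rfl
    rw [h3, ← tsum_mul_left]
    refine (norm_tsum_le_tsum_norm (summable_norm_act hP hPV f i)).trans ?_
    refine (summable_norm_act hP hPV f i).tsum_le_tsum (fun j => ?_) ((hPV.1 i).mul_left ‖f‖)
    rw [norm_smul, Real.norm_of_nonneg (hP.1 i j)]
    calc P i j * ‖f.toFun j‖ ≤ P i j * (‖f‖ * (V j : ℝ)) :=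
          mul_le_mul_of_nonneg_left (f.norm_toFun_le j) (hP.1 i j)
      _ = ‖f‖ * (P i j * (V j : ℝ)) := by ring
  calc ‖act P f.toFun i‖ ≤ ‖f‖ * iterV P V 1 i := h2
    _ ≤ ‖f‖ * ((⨆ n, iterV P V 1 n / (V n : ℝ)) * (V i : ℝ)) :=
        mul_le_mul_of_nonneg_left h1 (norm_nonneg _)
    _ = _ := by ring

/-- The bounded operator `f ↦ P f` on `B_V`. -/
def opBV (P : ℕ → ℕ → ℝ) (V : ℕ → Set.Ici (1 : ℝ)) (hP : IsMarkov P)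
    (hPV : DriftBounded P V) : BV V →L[ℂ] BV V :=
  LinearMap.mkContinuous
    { toFun := fun f => (⟨act P f.toFun, by
        refine ⟨(⨆ n, iterV P V 1 n / (V n : ℝ)) * ‖f‖, ?_⟩
        rintro _ ⟨n, rfl⟩
        exact (div_le_iff₀ (V_pos V n)).2 (norm_act_le hP hPV f n)⟩ : bvSubmodule V)
      map_add' := fun f g => BV.ext fun n => by
        change ∑' j, P n j • (f.toFun j + g.toFun j)
          = ∑' j, P n j • f.toFun j + ∑' j, P n j • g.toFun j
        rw [← (summable_norm_act hP hPV f n).of_norm.tsum_add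
          (summable_norm_act hP hPV g n).of_norm]
        simp only [smul_add]
      map_smul' := fun c f => BV.ext fun n => by
        change ∑' j, P n j • (c * f.toFun j) = c * ∑' j, P n j • f.toFun j
        rw [← tsum_mul_left]
        simp only [mul_smul_comm] }
    (⨆ n, iterV P V 1 n / (V n : ℝ))
    (fun f => BV.norm_le fun n => norm_act_le hP hPV f n)

theorem opBV_apply {P : ℕ → ℕ → ℝ} (hP : IsMarkov P) (hPV : DriftBounded P V) (f : BV V) (i : ℕ) :
    (opBV P V hP hPV f).toFun i = ∑' j, P i j • f.toFun j := rfl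

end MarkovBV

end

noncomputable section

namespace MarkovBV

/-! ### Spectral radius estimates -/

section Spectral

variable {E : Type*} [NormedAddCommGroup E] [NormedSpace ℂ E]

/-! Since `V` tends to infinity, an additive constant is negligible against `V`, and a failure of
`P^N V ≤ c V` at finitely many points can be absorbed into such a constant. So drift inequalities
with rate `c` and bounds on `ℓ_N` are interchangeable up to an arbitrarily small loss in `c`. This
gives (a) ⇔ (b) and `δ_V(P) = L`. Iterating a drift inequality, with `P 1 = 1` and a geometric
series for the constants, gives power-boundedness.

For `r_ess(P) ≤ L`, truncating `P^N f` to finitely many coordinates writes `P^N = K + R` with `K`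
compact and `‖R‖ ≤ 2c` (`exists_pow_opBV_eq_add`). A Riesz-type theory without contour integrals
then applies. The span `F` of the generalized eigenvectors with eigenvalue of modulus at least `r`
is finite-dimensional by Riesz's lemma (`finiteDimensional_outerSubmodule`). For any bounded
projection `Q₀` onto `F`, the powers of `T - Q₀ T` decay faster than `r^n`, because a compactness
argument excludes spectrum of modulus at least `r`. The limit of `(T|F)^{-n} Q₀ T^n` is a projection
onto `F` commuting with `T`, and its kernel is the space `H` (`exists_commuting_projection`). The
constant function, with eigenvalue 1, ensures that `F` is nonzero.

For `L ≤ r_ess(P)`, a decomposition at level `r` makes suitable powers `P^N` closer than `r^N` to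
compact operators, whereas the distance from `P^N` to the compact operators is at least `ℓ_N`
(`ell_le_norm_pow_opBV_sub`). To see the latter, cut `V` into successive finite blocks on each of
which `P^N` keeps norm at least `c < ℓ_N`. These blocks are weakly null, so a compact operator sends
a subsequence of them to zero in norm. -/

theorem isUnit_of_antilipschitz_of_near [CompleteSpace E] (T : E →L[ℂ] E) {z w : ℂ} {c : ℝ}
    (hc : 0 < c) (hT : ∀ x, c * ‖x‖ ≤ ‖T x - z • x‖) (hzw : ‖w - z‖ < c / 2)
    (hw : IsUnit (algebraMap ℂ (E →L[ℂ] E) w - T)) :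
    IsUnit (algebraMap ℂ (E →L[ℂ] E) z - T) := by
  obtain ⟨u, hu⟩ := hw
  rcases subsingleton_or_nontrivial E with hE | hE
  · exact ⟨1, by ext x; exact Subsingleton.elim _ _⟩
  -- Moving from `z` to `w` costs at most `c / 2` of the lower bound, so `w - T` is still bounded
  -- below by `c / 2`.
  have hinv : ‖(↑u⁻¹ : E →L[ℂ] E)‖ ≤ 2 / c := by
    refine ContinuousLinearMap.opNorm_le_bound _ (by positivity) fun y => ?_
    set x := (↑u⁻¹ : E →L[ℂ] E) y with hx
    have hy : y = w • x - T x := by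
      have h1 : (u : E →L[ℂ] E) ((↑u⁻¹ : E →L[ℂ] E) y) = y := by
        rw [← mul_apply_eq_comp, Units.mul_inv]; rfl
      rw [hu] at h1
      rw [← h1]
      simp [Algebra.algebraMap_eq_smul_one, ← hx]
    have h2 : T x - z • x = (w - z) • x - y := by rw [hy, sub_smul]; abel
    have h3 := hT x
    rw [h2] at h3
    have h4 := h3.trans (norm_sub_le _ _)
    rw [norm_smul] at h4
    have h5 : ‖w - z‖ * ‖x‖ ≤ c / 2 * ‖x‖ := by gcongr
    rw [div_mul_eq_mul_div, le_div_iff₀ hc]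
    nlinarith
  have hpos : 0 < ‖(↑u⁻¹ : E →L[ℂ] E)‖ := norm_pos_iff.2 u⁻¹.ne_zero
  have hnear : ‖(algebraMap ℂ (E →L[ℂ] E) z - T) - u‖ < ‖(↑u⁻¹ : E →L[ℂ] E)‖⁻¹ := by
    have h1 : (algebraMap ℂ (E →L[ℂ] E) z - T) - u = algebraMap ℂ (E →L[ℂ] E) (z - w) := by
      rw [hu, map_sub]; abel
    rw [h1, norm_algebraMap', norm_sub_rev]
    refine hzw.trans_le ?_
    rw [le_inv_comm₀ (by positivity) hpos]
    simpa using hinv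
  exact (u.ofNearby _ hnear).isUnit

/-- A spectral value `z` of maximal modulus is a limit of resolvent points `(1 + ε) z`, and
boundedness below would make `z` itself a resolvent point. Hence the spectral radius is below `r`,
and Gelfand's formula gives the decay. -/
theorem exists_norm_pow_le [CompleteSpace E] (T : E →L[ℂ] E) {r : ℝ} (hr : 0 < r)
    (h : ∀ z : ℂ, r ≤ ‖z‖ → ∃ c > 0, ∀ x, c * ‖x‖ ≤ ‖T x - z • x‖) :
    ∃ s C : ℝ, 0 < s ∧ s < r ∧ 0 ≤ C ∧ ∀ n : ℕ, ‖T ^ n‖ ≤ C * s ^ n := by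
  rcases subsingleton_or_nontrivial E with hE | hE
  · refine ⟨r / 2, 0, by positivity, by linarith, le_rfl, fun n => ?_⟩
    rw [Subsingleton.elim (T ^ n) 0]; simp
  obtain ⟨z, hz, hzr⟩ := spectrum.exists_nnnorm_eq_spectralRadius T
  have hlt : ‖z‖ < r := by
    by_contra! hle
    obtain ⟨c, hc, hb⟩ := h z hle
    have hz0 : 0 < ‖z‖ := hr.trans_le hle
    -- With this choice `(1 + ε) z` is at distance `c / 4 < c / 2` from `z`.
    set ε : ℝ := c / (4 * ‖z‖) with hε
    have hε0 : 0 < ε := by positivity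
    have hnorm : ‖((1 + ε : ℝ) : ℂ) * z‖ = (1 + ε) * ‖z‖ := by
      rw [norm_mul, Complex.norm_real, Real.norm_of_nonneg (by positivity)]
    refine hz (isUnit_of_antilipschitz_of_near T (w := ((1 + ε : ℝ) : ℂ) * z) hc hb ?_ ?_)
    · have : ((1 + ε : ℝ) : ℂ) * z - z = (ε : ℂ) * z := by push_cast; ring
      rw [this, norm_mul, Complex.norm_real, Real.norm_of_nonneg hε0.le, hε]
      field_simp
      norm_num
    · have : ((1 + ε : ℝ) : ℂ) * z ∈ resolventSet ℂ T := by
        refine spectrum.mem_resolventSet_of_spectralRadius_lt ?_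
        rw [← hzr, ENNReal.coe_lt_coe, ← NNReal.coe_lt_coe]
        simp only [coe_nnnorm]
        rw [hnorm]
        nlinarith
      exact this
  -- The maximum with 0 keeps `s` positive when the spectral radius vanishes.
  obtain ⟨s, hs1, hs2⟩ := exists_between (max_lt hlt hr)
  have hs0 : 0 < s := (le_max_right _ _).trans_lt hs1
  have hzs : ‖z‖ < s := (le_max_left _ _).trans_lt hs1
  have hev : ∀ᶠ n : ℕ in atTop, ‖T ^ n‖ / s ^ n ≤ 1 := by
    have ht := spectrum.pow_nnnorm_pow_one_div_tendsto_nhds_spectralRadius T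
    rw [← hzr] at ht
    have hlt' : ((‖z‖₊ : NNReal) : ENNReal) < ((s.toNNReal : NNReal) : ENNReal) :=
      ENNReal.coe_lt_coe.2 (Real.lt_toNNReal_iff_coe_lt.2 hzs)
    filter_upwards [ht.eventually (gt_mem_nhds hlt'), eventually_ge_atTop 1] with n hn hn1
    have hn0 : (n : ℝ) ≠ 0 := by positivity
    rw [div_le_one (by positivity)]
    have h1 := ENNReal.rpow_le_rpow hn.le (Nat.cast_nonneg n : (0 : ℝ) ≤ n)
    rw [← ENNReal.rpow_mul, one_div_mul_cancel hn0, ENNReal.rpow_one, ENNReal.rpow_natCast,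
      ← ENNReal.coe_pow, ENNReal.coe_le_coe, ← NNReal.coe_le_coe] at h1
    simpa [Real.coe_toNNReal s hs0.le] using h1
  obtain ⟨C, hC⟩ := (Filter.isBoundedUnder_of_eventually_le hev).bddAbove_range
  have hC' : ∀ n : ℕ, ‖T ^ n‖ ≤ C * s ^ n := fun n =>
    (div_le_iff₀ (by positivity)).1 (hC ⟨n, rfl⟩)
  refine ⟨s, C, hs0, hs2, ?_, hC'⟩
  have := (norm_nonneg _).trans (hC' 0)
  simpa using this

/-- If no such `c` existed, normalized approximate eigenvectors would accumulate at a unit vector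
`a` with `T a = z a`. -/
theorem exists_antilipschitz_of_compactness (T : E →L[ℂ] E) (z : ℂ)
    (hinj : ∀ x, T x = z • x → x = 0)
    (hcpt : ∀ x : ℕ → E, (∀ n, ‖x n‖ = 1) → Tendsto (fun n => T (x n) - z • x n) atTop (𝓝 0) →
      ∃ (φ : ℕ → ℕ) (a : E), StrictMono φ ∧ Tendsto (x ∘ φ) atTop (𝓝 a)) :
    ∃ c > 0, ∀ x, c * ‖x‖ ≤ ‖T x - z • x‖ := by
  by_contra! hcon
  choose y hy using fun n : ℕ => hcon (1 / ((n : ℝ) + 1)) (by positivity)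
  have hy0 : ∀ n, y n ≠ 0 := fun n h0 => by
    have := hy n
    simp [h0] at this
  set x : ℕ → E := fun n => ((‖y n‖⁻¹ : ℝ) : ℂ) • y n with hx
  have hx1 : ∀ n, ‖x n‖ = 1 := fun n => by
    simp [hx, norm_smul, inv_mul_cancel₀ (norm_ne_zero_iff.2 (hy0 n))]
  have hlim : Tendsto (fun n => T (x n) - z • x n) atTop (𝓝 0) := by
    refine squeeze_zero_norm (fun n => ?_) tendsto_one_div_add_atTop_nhds_zero_nat
    have h1 : T (x n) - z • x n = ((‖y n‖⁻¹ : ℝ) : ℂ) • (T (y n) - z • y n) := by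
      simp only [hx, map_smul, smul_sub, smul_comm z]
    rw [h1, norm_smul, Complex.norm_real, norm_inv, norm_norm,
      inv_mul_le_iff₀ (norm_pos_iff.2 (hy0 n)), mul_comm]
    exact (hy n).le
  obtain ⟨φ, a, hφ, ha⟩ := hcpt x hx1 hlim
  have ha1 : ‖a‖ = 1 := by
    have := ha.norm
    simp only [Function.comp_def, hx1] at this
    exact tendsto_nhds_unique this tendsto_const_nhds
  have hTa : Tendsto (fun n => T (x (φ n)) - z • x (φ n)) atTop (𝓝 (T a - z • a)) :=
    ((T.continuous.tendsto a).comp ha).sub (ha.const_smul z)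
  have h0 := tendsto_nhds_unique hTa (hlim.comp hφ.tendsto_atTop)
  rw [hinj a (sub_eq_zero.1 h0)] at ha1
  simp at ha1

end Spectral

/-! ### The sum of the generalized eigenspaces for eigenvalues of modulus at least `r` -/

section Outer

open Polynomial

variable {E : Type*} [AddCommGroup E] [Module ℂ E]

/-- The vectors annihilated by `∏ₐ (f - a)` for some finite family of scalars `|a| ≥ r`. -/
def outerSubmodule (f : Module.End ℂ E) (r : ℝ) : Submodule ℂ E where
  carrier := {x | ∃ s : Multiset ℂ, (∀ a ∈ s, r ≤ ‖a‖) ∧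
    aeval f (s.map fun a => X - C a).prod x = 0}
  zero_mem' := ⟨0, by simp, by simp⟩
  add_mem' := by
    rintro x y ⟨s, hs, hx⟩ ⟨t, ht, hy⟩
    refine ⟨s + t, fun a ha => ?_, ?_⟩
    · rcases Multiset.mem_add.1 ha with h | h
      exacts [hs a h, ht a h]
    · rw [Multiset.map_add, Multiset.prod_add, map_add]
      nth_rewrite 1 [mul_comm]
      rw [aeval_mul, aeval_mul, Module.End.mul_apply, Module.End.mul_apply, hx, hy]
      simp
  smul_mem' := by
    rintro c x ⟨s, hs, hx⟩
    exact ⟨s, hs, by rw [map_smul, hx, smul_zero]⟩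

variable {f : Module.End ℂ E} {r : ℝ}

theorem aeval_cons_apply (f : Module.End ℂ E) (a : ℂ) (s : Multiset ℂ) (x : E) :
    aeval f (((a ::ₘ s).map fun a => X - C a).prod) x =
      aeval f (s.map fun a => X - C a).prod (f x - a • x) := by
  rw [Multiset.map_cons, Multiset.prod_cons, mul_comm, aeval_mul, Module.End.mul_apply]
  congr 1
  simp [Module.algebraMap_end_apply]

theorem apply_mem_outerSubmodule {x : E} (hx : x ∈ outerSubmodule f r) :
    f x ∈ outerSubmodule f r := by
  obtain ⟨s, hs, hx⟩ := hx
  refine ⟨s, hs, ?_⟩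
  have h1 : ∀ q : ℂ[X], aeval f q (f x) = f (aeval f q x) := fun q => by
    have : aeval f (q * X) x = aeval f (X * q) x := by rw [mul_comm]
    simpa [aeval_mul] using this
  rw [h1, hx, map_zero]

theorem mem_outerSubmodule_of_sub_mem {x : E} {a : ℂ} (ha : r ≤ ‖a‖)
    (hx : f x - a • x ∈ outerSubmodule f r) : x ∈ outerSubmodule f r := by
  obtain ⟨s, hs, hx⟩ := hx
  refine ⟨a ::ₘ s, fun b hb => ?_, by rwa [aeval_cons_apply]⟩
  rcases Multiset.mem_cons.1 hb with rfl | h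
  exacts [ha, hs b h]

theorem le_norm_of_mem_outerSubmodule {x : E} {a : ℂ} (hx : x ∈ outerSubmodule f r)
    (hx0 : x ≠ 0) (hfx : f x = a • x) : r ≤ ‖a‖ := by
  obtain ⟨s, hs, hx⟩ := hx
  rw [Module.End.aeval_apply_of_hasEigenvector
    (Module.End.hasEigenvector_iff.2 ⟨Module.End.mem_eigenspace_iff.2 hfx, hx0⟩),
    smul_eq_zero, or_iff_left hx0, eval_multiset_prod, Multiset.prod_eq_zero_iff] at hx
  simp only [Multiset.map_map, Multiset.mem_map, Function.comp_apply, eval_sub, eval_X,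
    eval_C] at hx
  obtain ⟨b, hb, hab⟩ := hx
  rw [sub_eq_zero.1 hab]
  exact hs b hb

theorem ker_pow_le_outerSubmodule {a : ℂ} (ha : r ≤ ‖a‖) (p : ℕ) :
    LinearMap.ker ((f - a • LinearMap.id) ^ p) ≤ outerSubmodule f r := by
  intro x hx
  refine ⟨Multiset.replicate p a, fun b hb => ?_, ?_⟩
  · rwa [Multiset.eq_of_mem_replicate hb]
  · rw [Multiset.map_replicate, Multiset.prod_replicate, map_pow, map_sub, aeval_X, aeval_C,
      Algebra.algebraMap_eq_smul_one]
    exact hx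

/-- Induction on the factors: if `f x - a x` lies in an invariant `W`, adjoining `x` to `W` keeps it
invariant. -/
theorem exists_finiteDimensional_invariant {x : E} (hx : x ∈ outerSubmodule f r) :
    ∃ W : Submodule ℂ E, FiniteDimensional ℂ W ∧ W ≤ W.comap f ∧ x ∈ W := by
  obtain ⟨s, hs, hx⟩ := hx
  clear hs
  induction s using Multiset.induction generalizing x with
  | empty =>
    refine ⟨⊥, inferInstance, bot_le, ?_⟩
    simpa using hx
  | cons a s ih =>
    rw [aeval_cons_apply] at hx
    obtain ⟨W, hW, hinv, hmem⟩ := ih hx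
    refine ⟨W ⊔ Submodule.span ℂ {x}, inferInstance, sup_le ?_ ?_,
      Submodule.mem_sup_right (Submodule.mem_span_singleton_self x)⟩
    · exact hinv.trans (Submodule.comap_mono le_sup_left)
    · rw [Submodule.span_singleton_le_iff_mem, Submodule.mem_comap]
      have : f x = (f x - a • x) + a • x := by abel
      rw [this]
      exact add_mem (Submodule.mem_sup_left hmem) (Submodule.mem_sup_right
        (Submodule.smul_mem _ _ (Submodule.mem_span_singleton_self x)))

/-- Applying the factors `f - a` to `y` one by one ends at 0, which is in `W`. The last vector
before the orbit enters `W` is an eigenvector modulo `W`. -/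
theorem exists_sub_mem_of_notMem {W : Submodule ℂ E} {y : E} (hy : y ∈ outerSubmodule f r)
    (hyW : y ∉ W) : ∃ (a : ℂ) (z : E), r ≤ ‖a‖ ∧ z ∈ outerSubmodule f r ∧ z ∉ W ∧
      f z - a • z ∈ W := by
  obtain ⟨s, hs, hx⟩ := id hy
  induction s using Multiset.induction generalizing y with
  | empty => exact absurd (by simp at hx; simp [hx]) hyW
  | cons a s ih =>
    by_cases h : f y - a • y ∈ W
    · exact ⟨a, y, hs a (Multiset.mem_cons_self a s), hy, hyW, h⟩
    · rw [aeval_cons_apply] at hx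
      exact ih (sub_mem (apply_mem_outerSubmodule hy) (Submodule.smul_mem _ _ hy)) h
        (fun b hb => hs b (Multiset.mem_cons_of_mem hb)) hx

theorem pow_sub_mem {W : Submodule ℂ E} (hW : W ≤ W.comap f) {y : E} {a : ℂ}
    (hy : f y - a • y ∈ W) (n : ℕ) : (f ^ n) y - a ^ n • y ∈ W := by
  induction n with
  | zero => simp
  | succ n ih =>
    have : (f ^ (n + 1)) y - a ^ (n + 1) • y =
        f ((f ^ n) y - a ^ n • y) + a ^ n • (f y - a • y) := by
      rw [pow_succ', Module.End.mul_apply, map_sub, map_smul, smul_sub, smul_smul, pow_succ]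
      abel
    rw [this]
    exact add_mem (hW ih) (Submodule.smul_mem _ _ hy)

theorem pow_mem_of_le_comap {W : Submodule ℂ E} (hW : W ≤ W.comap f) {y : E} (hy : y ∈ W)
    (n : ℕ) : (f ^ n) y ∈ W := by
  induction n with
  | zero => simpa
  | succ n ih =>
    rw [pow_succ', Module.End.mul_apply]
    exact hW ih

end Outer

/-! ### Finite-dimensionality of the outer generalized eigenspaces -/

section OuterFinite

variable {E : Type*} [NormedAddCommGroup E] [NormedSpace ℂ E]

theorem coe_pow_apply (T : E →L[ℂ] E) (n : ℕ) (x : E) :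
    ((T : E →ₗ[ℂ] E) ^ n) x = (T ^ n) x := by
  rw [← ContinuousLinearMap.toLinearMap_pow]; rfl

theorem exists_seq_tendsto_of_isCompactOperator {K : E →L[ℂ] E} (hK : IsCompactOperator K)
    {x : ℕ → E} {M : ℝ} (hx : ∀ n, ‖x n‖ ≤ M) :
    ∃ (φ : ℕ → ℕ) (a : E), StrictMono φ ∧ Tendsto (fun n => K (x (φ n))) atTop (𝓝 a) := by
  obtain ⟨S, hS, hKS⟩ := hK.image_closedBall_subset_compact (f := (K : E →ₗ[ℂ] E)) M
  obtain ⟨a, -, φ, hφ, ha⟩ := hS.tendsto_subseq (x := fun n => K (x n)) fun n =>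
    hKS ⟨x n, by simpa using hx n, rfl⟩
  exact ⟨φ, a, hφ, ha⟩

/-- Riesz's lemma applied to an eigenvector `y` modulo a finite-dimensional invariant `U` containing
`s`: the difference `T^N y - T^N x` equals `a^N (y + u)` with `u ∈ U`, and `y` is at distance at
least 1 from `U`. -/
theorem exists_far_mem_outerSubmodule (T : E →L[ℂ] E) {r : ℝ} (hr : 0 < r) (N : ℕ)
    (hF : ¬ FiniteDimensional ℂ (outerSubmodule (T : E →ₗ[ℂ] E) r)) (s : Finset E)
    (hs : ∀ x ∈ s, x ∈ outerSubmodule (T : E →ₗ[ℂ] E) r) :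
    ∃ y ∈ outerSubmodule (T : E →ₗ[ℂ] E) r, ‖y‖ ≤ 2 ∧
      ∀ x ∈ s, r ^ N ≤ ‖(T ^ N) y - (T ^ N) x‖ := by
  set f : Module.End ℂ E := (T : E →ₗ[ℂ] E) with hf
  set F := outerSubmodule f r
  choose! W hWfin hWinv hWmem using
    fun x (hx : x ∈ F) => exists_finiteDimensional_invariant hx
  obtain ⟨U, hUfin, hUinv, hUF, hUmem⟩ : ∃ U : Submodule ℂ E, FiniteDimensional ℂ U ∧
      U ≤ U.comap f ∧ U ≤ F ∧ ∀ x ∈ s, x ∈ U := by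
    suffices h : ∃ U : Submodule ℂ E, FiniteDimensional ℂ U ∧ U ≤ U.comap f ∧ ∀ x ∈ s, x ∈ U by
      obtain ⟨U, h1, h2, h3⟩ := h
      exact ⟨U ⊓ F, Submodule.finiteDimensional_of_le inf_le_left,
        fun x hx => ⟨h2 hx.1, apply_mem_outerSubmodule hx.2⟩, inf_le_right,
        fun x hx => ⟨h3 x hx, hs x hx⟩⟩
    clear hF
    induction s using Finset.cons_induction with
    | empty => exact ⟨⊥, inferInstance, bot_le, by simp⟩
    | cons a s ha ih =>
      obtain ⟨U, h1, h2, h3⟩ := ih fun x hx => hs x (Finset.mem_cons_of_mem hx)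
      have haF := hs a (Finset.mem_cons_self a s)
      have := hWfin a haF
      refine ⟨U ⊔ W a, inferInstance, sup_le (h2.trans (Submodule.comap_mono le_sup_left))
        ((hWinv a haF).trans (Submodule.comap_mono le_sup_right)), fun x hx => ?_⟩
      rcases Finset.mem_cons.1 hx with rfl | hx
      · exact Submodule.mem_sup_right (hWmem _ haF)
      · exact Submodule.mem_sup_left (h3 x hx)
  obtain ⟨y, hyF, hyU⟩ : ∃ y ∈ F, y ∉ U := by
    by_contra! hle
    exact hF (Submodule.finiteDimensional_of_le hle)
  obtain ⟨a, z, ha, hzF, hzU, hz⟩ := exists_sub_mem_of_notMem hyF hyU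
  have hUcl : IsClosed (U : Set E) := U.closed_of_finiteDimensional
  set d := Metric.infDist z U with hd
  have hd0 : 0 < d := (hUcl.notMem_iff_infDist_pos ⟨0, U.zero_mem⟩).1 hzU
  -- An almost nearest point `w`: after scaling `z - w` by `1 / d` the distance to `U` is at least 1
  -- and the norm at most 2.
  obtain ⟨w, hwU, hw⟩ := (Metric.infDist_lt_iff (s := (U : Set E)) ⟨0, U.zero_mem⟩).1
    (show Metric.infDist z U < 2 * d by linarith)
  have hd0' : (d : ℂ) ≠ 0 := by exact_mod_cast hd0.ne'
  set y' : E := (d : ℂ)⁻¹ • (z - w) with hy'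
  have hy'F : y' ∈ F := Submodule.smul_mem _ _ (sub_mem hzF (hUF hwU))
  have hdist : ∀ u ∈ U, 1 ≤ ‖y' + u‖ := fun u hu => by
    have h1 : y' + u = (d : ℂ)⁻¹ • (z - (w - (d : ℂ) • u)) := by
      rw [hy', ← sub_add, smul_add, smul_smul, inv_mul_cancel₀ hd0', one_smul]
    have h2 : d ≤ ‖z - (w - (d : ℂ) • u)‖ := by
      rw [← dist_eq_norm]
      exact Metric.infDist_le_dist_of_mem (sub_mem hwU (U.smul_mem _ hu))
    rw [h1, norm_smul, norm_inv, Complex.norm_real, Real.norm_of_nonneg hd0.le,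
      le_inv_mul_iff₀ hd0, mul_one]
    exact h2
  have hsub : f y' - a • y' ∈ U := by
    have h1 : f y' - a • y' = (d : ℂ)⁻¹ • ((f z - a • z) - (f w - a • w)) := by
      rw [hy', map_smul, map_sub, smul_comm a, ← smul_sub, smul_sub a]
      congr 1; abel
    rw [h1]
    exact U.smul_mem _ (sub_mem hz (sub_mem (hUinv hwU) (U.smul_mem _ hwU)))
  refine ⟨y', hy'F, ?_, fun x hx => ?_⟩
  · rw [hy', norm_smul, norm_inv, Complex.norm_real, Real.norm_of_nonneg hd0.le,
      inv_mul_le_iff₀ hd0, ← dist_eq_norm, mul_comm]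
    exact hw.le
  · have ha0 : a ≠ 0 := norm_pos_iff.1 (hr.trans_le ha)
    set u := (f ^ N) y' - a ^ N • y' - (f ^ N) x with hu
    have huU : u ∈ U := sub_mem (pow_sub_mem hUinv hsub N) (pow_mem_of_le_comap hUinv (hUmem x hx) N)
    have h1 : (T ^ N) y' - (T ^ N) x = a ^ N • (y' + (a ^ N)⁻¹ • u) := by
      rw [smul_add, smul_inv_smul₀ (pow_ne_zero _ ha0), hu, hf,
        coe_pow_apply, coe_pow_apply]
      abel
    rw [h1, norm_smul, norm_pow]
    calc r ^ N = r ^ N * 1 := (mul_one _).symm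
      _ ≤ ‖a‖ ^ N * ‖y' + (a ^ N)⁻¹ • u‖ := by
        gcongr
        exact hdist _ (U.smul_mem _ huU)

/-- Otherwise there are vectors of norm at most 2 with `r^N`-separated images under `T^N`. Along a
subsequence the `K`-parts are Cauchy, and the `R`-parts differ by at most `4 ‖R‖ < r^N`. -/
theorem finiteDimensional_outerSubmodule (T K R : E →L[ℂ] E) {r : ℝ} (hr : 0 < r) (N : ℕ)
    (hT : T ^ N = K + R) (hK : IsCompactOperator K) (hR : 4 * ‖R‖ < r ^ N) :
    FiniteDimensional ℂ (outerSubmodule (T : E →ₗ[ℂ] E) r) := by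
  by_contra hF
  obtain ⟨x, hx, hfar⟩ := exists_seq_of_forall_finset_exists
    (fun x => x ∈ outerSubmodule (T : E →ₗ[ℂ] E) r ∧ ‖x‖ ≤ 2)
    (fun x y => r ^ N ≤ ‖(T ^ N) y - (T ^ N) x‖) fun s hs => by
      obtain ⟨y, h1, h2, h3⟩ := exists_far_mem_outerSubmodule T hr N hF s fun x hx => (hs x hx).1
      exact ⟨y, ⟨h1, h2⟩, h3⟩
  obtain ⟨φ, a, hφ, ha⟩ := exists_seq_tendsto_of_isCompactOperator hK fun n => (hx n).2
  obtain ⟨n₀, hn₀⟩ := Metric.cauchySeq_iff.1 ha.cauchySeq (r ^ N - 4 * ‖R‖) (by linarith)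
  have h1 := hn₀ (n₀ + 1) (by omega) n₀ le_rfl
  have h2 := hfar _ _ (hφ (Nat.lt_succ_self n₀))
  have h3 : (T ^ N) (x (φ (n₀ + 1))) - (T ^ N) (x (φ n₀)) =
      (K (x (φ (n₀ + 1))) - K (x (φ n₀))) + (R (x (φ (n₀ + 1))) - R (x (φ n₀))) := by
    rw [hT]; simp only [add_apply]; abel
  rw [h3] at h2
  have h4 : ∀ n, ‖R (x n)‖ ≤ ‖R‖ * 2 := fun n => R.le_of_opNorm_le_of_le le_rfl (hx n).2
  have h5 := norm_add_le (K (x (φ (n₀ + 1))) - K (x (φ n₀))) (R (x (φ (n₀ + 1))) - R (x (φ n₀)))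
  have h6 := norm_sub_le (R (x (φ (n₀ + 1)))) (R (x (φ n₀)))
  rw [dist_eq_norm] at h1
  linarith [h4 (φ (n₀ + 1)), h4 (φ n₀)]

end OuterFinite

/-! ### The spectral splitting of an operator with a power close to a compact operator -/

section Splitting

variable {E : Type*} [NormedAddCommGroup E] [NormedSpace ℂ E]

theorem exists_pow_sub_smul_eq_mul (T : E →L[ℂ] E) (z : ℂ) (N : ℕ) :
    ∃ S : E →L[ℂ] E, ∀ x, (T ^ N) x - z ^ N • x = S (T x - z • x) := by
  have hcomm : Commute T (z • (1 : E →L[ℂ] E)) := (Commute.one_right T).smul_right z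
  refine ⟨∑ i ∈ Finset.range N, T ^ i * (z • (1 : E →L[ℂ] E)) ^ (N - 1 - i), fun x => ?_⟩
  have h := congrArg (fun A : E →L[ℂ] E => A x) (hcomm.geom_sum₂_mul N)
  simp only [smul_pow, one_pow] at h
  simpa [smul_pow] using h.symm

theorem isUnit_smul_one_sub [CompleteSpace E] {R : E →L[ℂ] E} {z : ℂ} (h : ‖R‖ < ‖z‖) :
    IsUnit (z • (1 : E →L[ℂ] E) - R) := by
  rw [← Algebra.algebraMap_eq_smul_one]
  refine spectrum.mem_resolventSet_of_norm_lt_mul (lt_of_le_of_lt ?_ h)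
  exact mul_le_of_le_one_right (norm_nonneg _) ContinuousLinearMap.norm_id_le

theorem isCompactOperator_subtypeL_comp {F : Submodule ℂ E} [FiniteDimensional ℂ F]
    (g : E →L[ℂ] F) : IsCompactOperator (F.subtypeL ∘L g) := by
  have := FiniteDimensional.proper ℂ F
  have hg : IsCompactOperator g := isCompactOperator_of_locallyCompactSpace_dom g
  exact hg.clm_comp F.subtypeL

/-- With `T^N - z^N = S (T - z)`, one has `(z^N - R) x = (K - S A) x - S ((T - A) x - z x)`. The
left operator is invertible, `K - S A` is compact, and the last term tends to 0. -/
theorem exists_tendsto_of_pow_eq_add [CompleteSpace E] {T K R : E →L[ℂ] E} {N : ℕ}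
    (hT : T ^ N = K + R) (hK : IsCompactOperator K) {z : ℂ} (hz : ‖R‖ < ‖z‖ ^ N)
    {A : E →L[ℂ] E} (hA : IsCompactOperator A) {x : ℕ → E} {M : ℝ} (hx : ∀ n, ‖x n‖ ≤ M)
    (hlim : Tendsto (fun n => (T - A) (x n) - z • x n) atTop (𝓝 0)) :
    ∃ (φ : ℕ → ℕ) (a : E), StrictMono φ ∧ Tendsto (x ∘ φ) atTop (𝓝 a) := by
  obtain ⟨S, hS⟩ := exists_pow_sub_smul_eq_mul T z N
  obtain ⟨u, hu⟩ := isUnit_smul_one_sub (R := R) (z := z ^ N) (by rwa [norm_pow])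
  have hK' : IsCompactOperator (K - S ∘L A) := hK.sub (hA.clm_comp S)
  obtain ⟨φ, a, hφ, ha⟩ := exists_seq_tendsto_of_isCompactOperator hK' hx
  have h1 : ∀ n, x n = (↑u⁻¹ : E →L[ℂ] E) ((K - S ∘L A) (x n) -
      S ((T - A) (x n) - z • x n)) := fun n => by
    have h2 : (K - S ∘L A) (x n) - S ((T - A) (x n) - z • x n) = (u : E →L[ℂ] E) (x n) := by
      have h3 := hS (x n)
      rw [hT] at h3
      rw [hu]
      simp only [sub_apply, add_apply, smul_apply, ContinuousLinearMap.comp_apply,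
        one_apply_eq_self, map_sub] at h3 ⊢
      calc _ = K (x n) - (S (T (x n)) - S (z • x n)) := by abel
        _ = _ := by rw [← h3]; abel
    rw [h2, ← mul_apply_eq_comp, Units.inv_mul]; rfl
  refine ⟨φ, (↑u⁻¹ : E →L[ℂ] E) (a - S 0), hφ, ?_⟩
  have h4 := ((↑u⁻¹ : E →L[ℂ] E).continuous.tendsto _).comp
    (ha.sub ((S.continuous.tendsto 0).comp (hlim.comp hφ.tendsto_atTop)))
  refine h4.congr fun n => ?_
  exact (h1 (φ n)).symm

/-- An eigenvector `x` of `T - Q T` for `|z| ≥ r` satisfies `T x - z x = Q T x ∈ F`, hence lies in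
`F`. But `T - Q T` vanishes on `F`, so `z x = 0`. -/
theorem exists_norm_compl_pow_le [CompleteSpace E] {T K R : E →L[ℂ] E} {N : ℕ} {r : ℝ}
    (hr : 0 < r) (hT : T ^ N = K + R) (hK : IsCompactOperator K) (hR : ‖R‖ < r ^ N)
    {Q : E →L[ℂ] E} (hQ : IsCompactOperator Q)
    (hQmem : ∀ x, Q x ∈ outerSubmodule (T : E →ₗ[ℂ] E) r)
    (hQid : ∀ x ∈ outerSubmodule (T : E →ₗ[ℂ] E) r, Q x = x) :
    ∃ s C : ℝ, 0 < s ∧ s < r ∧ 0 ≤ C ∧ ∀ n : ℕ, ‖(T - Q ∘L T) ^ n‖ ≤ C * s ^ n := by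
  refine exists_norm_pow_le _ hr fun z hz => ?_
  have hz0 : z ≠ 0 := norm_pos_iff.1 (hr.trans_le hz)
  refine exists_antilipschitz_of_compactness _ z (fun x hx => ?_) fun x hx hlim => ?_
  · simp only [sub_apply, ContinuousLinearMap.comp_apply] at hx
    have h1 : T x - z • x = Q (T x) := by rw [← hx]; abel
    have hxF : x ∈ outerSubmodule (T : E →ₗ[ℂ] E) r := by
      refine mem_outerSubmodule_of_sub_mem hz ?_
      rw [ContinuousLinearMap.coe_coe, h1]
      exact hQmem _
    have h2 : Q (T x) = T x := hQid _ (apply_mem_outerSubmodule hxF)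
    rw [h2, sub_self] at hx
    exact (smul_eq_zero.1 hx.symm).resolve_left hz0
  · refine exists_tendsto_of_pow_eq_add hT hK (z := z) ?_ (hQ.comp_clm T) (fun n => (hx n).le) hlim
    exact hR.trans_le (by gcongr)

theorem exists_inverse_on_outerSubmodule [CompleteSpace E] (T : E →L[ℂ] E) {r : ℝ} (hr : 0 < r)
    {F : Submodule ℂ E}
    (hF : F = outerSubmodule (T : E →ₗ[ℂ] E) r) [FiniteDimensional ℂ F] (g : E →L[ℂ] F)
    (hg : ∀ x : F, g x = x) :
    ∃ G : E →L[ℂ] E, IsCompactOperator G ∧ (∀ x, G x ∈ F) ∧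
      (∀ x ∈ F, G (T x) = x) ∧ ∀ x ∈ F, T (G x) = x := by
  have hTF : ∀ x ∈ F, T x ∈ F := by
    rw [hF]; exact fun x hx => apply_mem_outerSubmodule hx
  set TF : F →ₗ[ℂ] F := (T : E →ₗ[ℂ] E).restrict hTF with hTF_def
  have hinj : Function.Injective TF := by
    rw [← LinearMap.ker_eq_bot, LinearMap.ker_eq_bot']
    intro x hx
    by_contra hx0
    have h1 : (T : E →ₗ[ℂ] E) x = (0 : ℂ) • (x : E) := by
      rw [zero_smul]; exact congrArg Subtype.val hx
    have := le_norm_of_mem_outerSubmodule (r := r) (by rw [← hF]; exact x.2) (by simpa using hx0) h1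
    rw [norm_zero] at this
    linarith
  set e := LinearEquiv.ofInjectiveEndo TF hinj with he
  have hTG : ∀ y : F, T (e.symm y : E) = y := fun y => by
    have h1 : e (e.symm y) = y := e.apply_symm_apply y
    exact congrArg Subtype.val h1
  refine ⟨F.subtypeL ∘L (LinearMap.toContinuousLinearMap (e.symm : F →ₗ[ℂ] F) ∘L g),
    isCompactOperator_subtypeL_comp _, fun x => Subtype.property _, fun x hx => ?_, fun x hx => ?_⟩
  · have hx' : T x ∈ F := hTF x hx
    have h1 : g (T x) = e ⟨x, hx⟩ := hg ⟨T x, hx'⟩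
    simp [h1]
  · have h1 : g x = ⟨x, hx⟩ := hg ⟨x, hx⟩
    simp [h1, hTG]

/-- A nonzero eigenvalue of `G` is the inverse of an eigenvalue of `T` on the outer space, so its
modulus is at most `1 / r < 1 / t`. -/
theorem exists_norm_inverse_pow_le [CompleteSpace E] {T G : E →L[ℂ] E} {r t : ℝ} (ht : 0 < t)
    (htr : t < r) (hG : IsCompactOperator G)
    (hGmem : ∀ x, G x ∈ outerSubmodule (T : E →ₗ[ℂ] E) r)
    (hTG : ∀ x ∈ outerSubmodule (T : E →ₗ[ℂ] E) r, T (G x) = x) :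
    ∃ s C : ℝ, 0 < s ∧ s < t⁻¹ ∧ 0 ≤ C ∧ ∀ n : ℕ, ‖G ^ n‖ ≤ C * s ^ n := by
  refine exists_norm_pow_le _ (inv_pos.2 ht) fun z hz => ?_
  have hz0 : z ≠ 0 := norm_pos_iff.1 ((inv_pos.2 ht).trans_le hz)
  refine exists_antilipschitz_of_compactness _ z (fun x hx => ?_) fun x hx hlim => ?_
  · have hxF : x ∈ outerSubmodule (T : E →ₗ[ℂ] E) r := by
      rw [← inv_smul_smul₀ hz0 x, ← hx]
      exact Submodule.smul_mem _ _ (hGmem x)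
    by_contra hx0
    have h1 := hTG x hxF
    rw [hx, map_smul] at h1
    have h2 : (T : E →ₗ[ℂ] E) x = z⁻¹ • x := by
      rw [eq_inv_smul_iff₀ hz0]; exact h1
    have h3 := le_norm_of_mem_outerSubmodule hxF hx0 h2
    rw [norm_inv] at h3
    have h4 := inv_le_of_inv_le₀ ht hz
    linarith
  · obtain ⟨φ, a, hφ, ha⟩ := exists_seq_tendsto_of_isCompactOperator hG fun n => (hx n).le
    refine ⟨φ, z⁻¹ • (a - 0), hφ, ((ha.sub (hlim.comp hφ.tendsto_atTop)).const_smul z⁻¹).congr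
      fun n => ?_⟩
    simp [hz0]

/-- The Riesz-type projection onto the outer generalized eigenspaces. -/
theorem exists_commuting_projection [CompleteSpace E] {T K R : E →L[ℂ] E} {N : ℕ} {r : ℝ}
    (hr : 0 < r) (hT : T ^ N = K + R) (hK : IsCompactOperator K) (hR : 4 * ‖R‖ < r ^ N) :
    ∃ Q : E →L[ℂ] E, (∀ x, Q x ∈ outerSubmodule (T : E →ₗ[ℂ] E) r) ∧
      (∀ x ∈ outerSubmodule (T : E →ₗ[ℂ] E) r, Q x = x) ∧ (∀ x, Q (T x) = T (Q x)) ∧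
      ∃ s C : ℝ, 0 < s ∧ s < r ∧ ∀ (n : ℕ) (x : E), Q x = 0 → ‖(T ^ n) x‖ ≤ C * s ^ n * ‖x‖ := by
  have hfin := finiteDimensional_outerSubmodule T K R hr N hT hK hR
  set F := outerSubmodule (T : E →ₗ[ℂ] E) r with hF
  obtain ⟨g, hg⟩ := Submodule.ClosedComplemented.of_finiteDimensional (𝕜 := ℂ) F
  set Q₀ : E →L[ℂ] E := F.subtypeL ∘L g with hQ₀
  have hQmem : ∀ x, Q₀ x ∈ F := fun x => Subtype.property _
  have hQid : ∀ x ∈ F, Q₀ x = x := fun x hx => congrArg Subtype.val (hg ⟨x, hx⟩)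
  have hTF : ∀ x ∈ F, T x ∈ F := fun x hx => apply_mem_outerSubmodule hx
  obtain ⟨s, C, hs, hsr, hC, hB⟩ := exists_norm_compl_pow_le hr hT hK
    (by linarith [norm_nonneg R]) (isCompactOperator_subtypeL_comp g) hQmem hQid
  set B := T - Q₀ ∘L T with hBdef
  obtain ⟨G, hGc, hGmem, hGT, hTG⟩ := exists_inverse_on_outerSubmodule T hr hF g hg
  -- The gap between `s` and `r` makes the growth `u < 1 / t` of `G ^ n` lose against the decay `s <
  -- t` of `B ^ n`: `u * s < 1`.
  obtain ⟨t, hst, htr⟩ := exists_between hsr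
  obtain ⟨u, C', hu, hut, hC', hG⟩ := exists_norm_inverse_pow_le (hs.trans hst) htr hGc hGmem hTG
  -- the complementary projection intertwines `T` with `B`
  have hcompl : ∀ (n : ℕ) (x : E), (T ^ n) x - Q₀ ((T ^ n) x) = (B ^ n) (x - Q₀ x) := by
    intro n
    induction n with
    | zero => simp
    | succ n ih =>
      intro x
      rw [pow_succ', pow_succ', mul_apply_eq_comp, mul_apply_eq_comp, ← ih, hBdef]
      simp only [sub_apply, ContinuousLinearMap.comp_apply, map_sub]
      rw [hQid _ (hTF _ (hQmem ((T ^ n) x)))]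
      abel
  -- The commutator vanishes on `F`, so on `T^n x` it sees only the complementary part `B^n (x - Q₀
  -- x)`, which is small.
  set D : E →L[ℂ] E := Q₀ ∘L T - T ∘L Q₀ with hD
  have hDF : ∀ x ∈ F, D x = 0 := fun x hx => by
    simp [hD, hQid x hx, hQid _ (hTF x hx)]
  set a : ℕ → E →L[ℂ] E := fun n => G ^ n * Q₀ * T ^ n with ha
  have hpowF : ∀ (n : ℕ), ∀ x ∈ F, (G ^ n) x ∈ F := by
    intro n x hx
    cases n with
    | zero => simpa
    | succ n => rw [pow_succ']; exact hGmem _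
  have hstep : ∀ n, a (n + 1) - a n = G ^ (n + 1) * D * B ^ n * (1 - Q₀) := by
    intro n
    ext x
    have h1 : D ((T ^ n) x) = D ((B ^ n) (x - Q₀ x)) := by
      rw [← hcompl, map_sub, hDF _ (hQmem _), sub_zero]
    have h2 : (G ^ n) (Q₀ ((T ^ n) x)) = (G ^ (n + 1)) (T (Q₀ ((T ^ n) x))) := by
      rw [pow_succ G, mul_apply_eq_comp, hGT _ (hQmem _)]
    simp only [ha, sub_apply, mul_apply_eq_comp, one_apply_eq_self]
    rw [← h1, h2, hD, pow_succ' T, mul_apply_eq_comp, ← map_sub]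
    rfl
  have hus : u * s < 1 := by
    have : u * s < t⁻¹ * t := mul_lt_mul'' hut hst hu.le hs.le
    rwa [inv_mul_cancel₀ (hs.trans hst).ne'] at this
  have hcauchy : CauchySeq a := by
    refine cauchySeq_of_le_geometric (u * s) (C' * u * ‖D‖ * C * ‖(1 - Q₀ : E →L[ℂ] E)‖) hus
      fun n => ?_
    rw [dist_comm, dist_eq_norm, hstep]
    calc ‖G ^ (n + 1) * D * B ^ n * (1 - Q₀)‖
        ≤ ‖G ^ (n + 1)‖ * ‖D‖ * ‖B ^ n‖ * ‖(1 - Q₀ : E →L[ℂ] E)‖ := by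
          refine (norm_mul_le _ _).trans ?_
          gcongr
          refine (norm_mul_le _ _).trans ?_
          gcongr
          exact norm_mul_le _ _
      _ ≤ (C' * u ^ (n + 1)) * ‖D‖ * (C * s ^ n) * ‖(1 - Q₀ : E →L[ℂ] E)‖ := by
          gcongr
          exacts [hG _, hB n]
      _ = _ := by rw [mul_pow]; ring
  obtain ⟨Q, hQ⟩ := cauchySeq_tendsto_of_complete hcauchy
  have hQx : ∀ x, Tendsto (fun n => a n x) atTop (𝓝 (Q x)) := fun x =>
    ((ContinuousLinearMap.apply ℂ E x).continuous.tendsto Q).comp hQ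
  have hQF : ∀ x, Q x ∈ F := fun x =>
    F.closed_of_finiteDimensional.mem_of_tendsto (hQx x)
      (Eventually.of_forall fun n => hpowF n _ (hQmem _))
  have hQid' : ∀ x ∈ F, Q x = x := fun x hx => by
    have h1 : ∀ n, a n x = x := by
      have hTn : ∀ n, (T ^ n) x ∈ F := fun n => by
        have := pow_mem_of_le_comap (f := (T : E →ₗ[ℂ] E)) (W := F) (fun y hy => hTF y hy) hx n
        rwa [coe_pow_apply] at this
      intro n
      induction n with
      | zero => simp [ha, hQid x hx]
      | succ n ih =>
        have h2 := congrArg (fun A : E →L[ℂ] E => A x) (hstep n)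
        simp only [sub_apply, mul_apply_eq_comp, one_apply_eq_self, hQid x hx, sub_self,
          map_zero] at h2
        rw [sub_eq_zero.1 h2, ih]
    exact tendsto_nhds_unique (hQx x) (by simp [h1])
  have hcomm : ∀ x, Q (T x) = T (Q x) := fun x => by
    refine tendsto_nhds_unique (hQx (T x)) ?_
    -- The limit commutes with `T` because `T (a (n + 1) x) = a n (T x)`.
    refine ((T.continuous.tendsto _).comp ((hQx x).comp (tendsto_add_atTop_nat 1))).congr fun n => ?_
    simp only [Function.comp_apply, ha, mul_apply_eq_comp]
    rw [pow_succ' G, mul_apply_eq_comp, hTG _ (hpowF n _ (hQmem _)), pow_succ T, mul_apply_eq_comp]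
  refine ⟨Q, hQF, hQid', hcomm, s, ‖(1 - Q : E →L[ℂ] E)‖ * C * ‖(1 - Q₀ : E →L[ℂ] E)‖, hs,
    hsr, fun n x hx => ?_⟩
  · have hQn : Q ((T ^ n) x) = 0 := by
      clear_value a
      induction n with
      | zero => simpa
      | succ n ih => rw [pow_succ', mul_apply_eq_comp, hcomm, ih, map_zero]
    -- `1 - Q` kills the component `Q₀ T^n x ∈ F` and fixes `T^n x ∈ ker Q`.
    have h1 : (T ^ n) x = ((1 - Q) * B ^ n * (1 - Q₀)) x := by
      simp only [mul_apply_eq_comp, sub_apply, one_apply_eq_self]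
      rw [← hcompl, map_sub, hQn, hQid' _ (hQmem _)]
      abel
    rw [h1]
    refine ContinuousLinearMap.le_of_opNorm_le _ ?_ x
    calc ‖(1 - Q) * B ^ n * (1 - Q₀)‖
        ≤ ‖(1 - Q : E →L[ℂ] E)‖ * ‖B ^ n‖ * ‖(1 - Q₀ : E →L[ℂ] E)‖ := by
          refine (norm_mul_le _ _).trans ?_
          gcongr
          exact norm_mul_le _ _
      _ ≤ ‖(1 - Q : E →L[ℂ] E)‖ * (C * s ^ n) * ‖(1 - Q₀ : E →L[ℂ] E)‖ := by
          gcongr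
          exact hB n
      _ = _ := by ring

end Splitting

/-! ### From the spectral splitting to quasi-compactness -/

section Quasi

theorem iSupIndep_option_elim {R M ι : Type*} [Ring R] [AddCommGroup M] [Module R M]
    {H : Submodule R M} {G : ι → Submodule R M} (hG : iSupIndep G) (hH : Disjoint H (⨆ i, G i)) :
    iSupIndep fun o : Option ι => o.elim H G := by
  intro o
  cases o with
  | none =>
    refine hH.mono_right (iSup₂_le fun j hj => ?_)
    cases j with
    | none => exact absurd rfl hj
    | some j => exact le_iSup G j
  | some i =>
    have h1 : Disjoint (G i) ((⨆ (j) (_ : j ≠ i), G j) ⊔ H) :=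
      Disjoint.disjoint_sup_right_of_disjoint_sup_left (hG i)
        (hH.symm.mono_left (sup_le (le_iSup G i) (iSup₂_le fun j _ => le_iSup G j)))
    refine h1.mono_right (iSup₂_le fun j hj => ?_)
    cases j with
    | none => exact le_sup_right
    | some j => exact le_sup_of_le_left (le_iSup₂_of_le j (fun h => hj (h ▸ rfl)) le_rfl)

variable {E : Type*} [NormedAddCommGroup E] [NormedSpace ℂ E]

/-- Over `ℂ` the generalized eigenspaces of `f` on `F` span `F`, and the exponent `dim F` suffices
for all of them. -/
theorem le_iSup_ker_pow_finrank {V : Type*} [AddCommGroup V] [Module ℂ V] (f : Module.End ℂ V)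
    (F : Submodule ℂ V) [FiniteDimensional ℂ F] (hF : ∀ x ∈ F, f x ∈ F) :
    F ≤ ⨆ (a : ℂ) (_ : Module.End.HasEigenvalue (f.restrict hF) a),
      LinearMap.ker ((f - a • LinearMap.id) ^ Module.finrank ℂ F) := by
  have h1 : F = (⨆ a : ℂ, Module.End.maxGenEigenspace (f.restrict hF) a).map F.subtype := by
    rw [Module.End.iSup_maxGenEigenspace_eq_top, Submodule.map_top, Submodule.range_subtype]
  conv_lhs => rw [h1]
  rw [Submodule.map_iSup]
  refine iSup_le fun a => ?_
  by_cases ha : Module.End.HasEigenvalue (f.restrict hF) a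
  · refine le_iSup₂_of_le a ha ?_
    rw [Module.End.maxGenEigenspace_eq_genEigenspace_finrank, Module.End.genEigenspace_restrict]
    refine (Submodule.map_comap_le _ _).trans ?_
    rw [Module.End.genEigenspace_nat]
    rfl
  · have h2 : Module.End.maxGenEigenspace (f.restrict hF) a = ⊥ := by
      by_contra hne
      exact ha (Module.End.HasUnifEigenvalue.lt (k := ⊤) zero_lt_one hne)
    rw [h2, Submodule.map_bot]
    exact bot_le

theorem bddAbove_norm_apply (A : E →L[ℂ] E) (H : Submodule ℂ E) :
    BddAbove (Set.range fun h : {h : E // h ∈ H ∧ ‖h‖ ≤ 1} => ‖A (h : E)‖) := by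
  refine ⟨‖A‖, ?_⟩
  rintro _ ⟨h, rfl⟩
  simpa using A.le_of_opNorm_le_of_le le_rfl h.2.2

theorem sInf_iSup_norm_pow_lt (T : E →L[ℂ] E) {H : Submodule ℂ E} {s r C : ℝ} (hs : 0 < s)
    (hsr : s < r) (hT : ∀ (n : ℕ), ∀ x ∈ H, ‖(T ^ n) x‖ ≤ C * s ^ n * ‖x‖) :
    sInf {x : ℝ | ∃ n : ℕ, 1 ≤ n ∧
      x = (⨆ h : {h : E // h ∈ H ∧ ‖h‖ ≤ 1}, ‖(T ^ n) (h : E)‖) ^ (1 / (n : ℝ))} < r := by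
  have hr : 0 < r := hs.trans hsr
  set C' := max C 1 with hC'
  have hC'0 : 0 < C' := lt_max_of_lt_right one_pos
  obtain ⟨n, hn⟩ := exists_pow_lt_of_lt_one (inv_pos.2 hC'0) ((div_lt_one hr).2 hsr)
  have hn' : C' * s ^ (n + 1) < r ^ (n + 1) := by
    have h1 : (s / r) ^ (n + 1) < C'⁻¹ :=
      (pow_le_pow_of_le_one (by positivity) ((div_lt_one hr).2 hsr).le n.le_succ).trans_lt hn
    rw [div_pow, div_lt_iff₀ (by positivity), inv_mul_eq_div, lt_div_iff₀ hC'0] at h1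
    linarith
  have h0 : 0 ≤ ⨆ h : {h : E // h ∈ H ∧ ‖h‖ ≤ 1}, ‖(T ^ (n + 1)) (h : E)‖ :=
    Real.iSup_nonneg fun _ => norm_nonneg _
  have hsup : (⨆ h : {h : E // h ∈ H ∧ ‖h‖ ≤ 1}, ‖(T ^ (n + 1)) (h : E)‖) ≤ C' * s ^ (n + 1) := by
    refine Real.iSup_le (fun h => (hT (n + 1) h h.2.1).trans ?_) (by positivity)
    calc C * s ^ (n + 1) * ‖(h : E)‖ ≤ C' * s ^ (n + 1) * 1 := by
          gcongr
          exacts [le_max_left _ _, h.2.2]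
      _ = _ := mul_one _
  refine csInf_lt_of_lt ⟨0, ?_⟩ ⟨n + 1, by omega, rfl⟩ ?_
  · rintro _ ⟨k, -, rfl⟩
    exact Real.rpow_nonneg (Real.iSup_nonneg fun _ => norm_nonneg _) _
  · calc _ < (r ^ (n + 1)) ^ (1 / ((n + 1 : ℕ) : ℝ)) :=
          Real.rpow_lt_rpow h0 (hsup.trans_lt hn') (by positivity)
      _ = r := by rw [one_div, Real.pow_rpow_inv_natCast hr.le (by omega)]

/-- The outer space splits into kernels with the common exponent `dim F`, and `H` is the kernel of
the commuting projection. The eigenvector `v` provides `m ≥ 1`. -/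
theorem qcDecomposition_of_pow_eq_add [CompleteSpace E] {T K R : E →L[ℂ] E} {N : ℕ} {r : ℝ}
    (hr : 0 < r) (hT : T ^ N = K + R) (hK : IsCompactOperator K) (hR : 4 * ‖R‖ < r ^ N)
    {z : ℂ} (hz : r ≤ ‖z‖) {v : E} (hv : v ≠ 0) (hTv : T v = z • v) : QCDecomposition T r := by
  have hfin := finiteDimensional_outerSubmodule T K R hr N hT hK hR
  obtain ⟨Q, hQmem, hQid, hcomm, s, C, hs, hsr, hQ⟩ := exists_commuting_projection hr hT hK hR
  set f : Module.End ℂ E := (T : E →ₗ[ℂ] E) with hf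
  set F := outerSubmodule f r with hF
  have hfF : ∀ x ∈ F, f x ∈ F := fun x hx => apply_mem_outerSubmodule hx
  have hvF : v ∈ F := mem_outerSubmodule_of_sub_mem (a := z) hz (by
    have : f v = z • v := hTv
    rw [this, sub_self]; exact zero_mem _)
  have hfinS : {a : ℂ | Module.End.HasEigenvalue (f.restrict hfF) a}.Finite :=
    Module.End.finite_hasEigenvalue _
  set S := hfinS.toFinset with hS
  have hmemS : ∀ a, a ∈ S ↔ Module.End.HasEigenvalue (f.restrict hfF) a := fun a => by simp [hS]
  have hev : ∀ a ∈ S, ∃ x ∈ F, x ≠ 0 ∧ f x = a • x := fun a ha => by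
    obtain ⟨x, hx⟩ := ((hmemS a).1 ha).exists_hasEigenvector
    refine ⟨x, x.2, by simpa using hx.2, ?_⟩
    simpa using congrArg Subtype.val hx.apply_eq_smul
  have hzS : z ∈ S := (hmemS z).2 (Module.End.hasEigenvalue_of_hasEigenvector (x := ⟨v, hvF⟩)
    (Module.End.hasEigenvector_iff.2 ⟨Module.End.mem_eigenspace_iff.2 (Subtype.ext hTv),
      by simpa [Subtype.ext_iff] using hv⟩))
  have hle : ∀ a ∈ S, r ≤ ‖a‖ := fun a ha => by
    obtain ⟨x, hx, hx0, hfx⟩ := hev a ha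
    exact le_norm_of_mem_outerSubmodule hx hx0 hfx
  set d := Module.finrank ℂ F with hd
  have hd1 : 1 ≤ d := by
    have : Nontrivial F := ⟨⟨⟨v, hvF⟩, 0, by simpa [Subtype.ext_iff] using hv⟩⟩
    exact Module.finrank_pos
  set lam : Fin S.card → ℂ := fun i => (S.equivFin.symm i : ℂ) with hlam
  have hlamS : ∀ i, lam i ∈ S := fun i => (S.equivFin.symm i).2
  have hlaminj : Function.Injective lam :=
    Subtype.val_injective.comp S.equivFin.symm.injective
  set G : Fin S.card → Submodule ℂ E := fun i =>
    LinearMap.ker ((f - lam i • LinearMap.id) ^ d) with hG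
  have hGF : ∀ i, G i ≤ F := fun i => ker_pow_le_outerSubmodule (hle _ (hlamS i)) d
  have hsup : ⨆ i, G i = F := by
    refine le_antisymm (iSup_le hGF) ((le_iSup_ker_pow_finrank f F hfF).trans
      (iSup₂_le fun a ha => ?_))
    have h1 : lam (S.equivFin ⟨a, (hmemS a).2 ha⟩) = a := by simp [hlam]
    refine le_iSup_of_le (S.equivFin ⟨a, (hmemS a).2 ha⟩) ?_
    rw [hG]
    simp only [h1]
    exact le_rfl
  have hindep : iSupIndep G := by
    have h1 := (f.independent_genEigenspace (d : ℕ∞)).comp hlaminj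
    refine h1.mono fun i => ?_
    simp only [Function.comp_apply]
    rw [Module.End.genEigenspace_nat]
    exact le_rfl
  set H : Submodule ℂ E := LinearMap.ker (Q : E →ₗ[ℂ] E) with hH
  have hmemH : ∀ x, x ∈ H ↔ Q x = 0 := fun x => LinearMap.mem_ker
  have hdisj : Disjoint H (⨆ i, G i) := by
    rw [hsup, Submodule.disjoint_def]
    intro x hx hxF
    rw [← hQid x hxF]
    exact hx
  refine ⟨S.card, lam, fun _ => d, H, Finset.card_pos.2 ⟨z, hzS⟩, fun _ => hd1, ?_,
    fun i => hle _ (hlamS i), fun i => ?_, Q.isClosed_ker, fun h hh => ?_,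
    sInf_iSup_norm_pow_lt T hs hsr fun n x hx => hQ n x hx⟩
  · refine DirectSum.isInternal_submodule_of_iSupIndep_of_iSup_eq_top
      (iSupIndep_option_elim hindep hdisj) ?_
    rw [iSup_option]
    change H ⊔ ⨆ i, G i = ⊤
    rw [hsup, eq_top_iff]
    intro x _
    rw [← sub_add_cancel x (Q x)]
    refine Submodule.add_mem_sup ((hmemH _).2 ?_) (hQmem x)
    rw [map_sub, hQid _ (hQmem x), sub_self]
  · have h1 : FiniteDimensional ℂ (G i) := Submodule.finiteDimensional_of_le (hGF i)
    refine ⟨h1, ?_⟩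
    obtain ⟨x, hx, hx0, hfx⟩ := hev _ (hlamS i)
    have hxG : x ∈ G i := by
      have h2 : (f - lam i • LinearMap.id : Module.End ℂ E) x = 0 := by
        simp [LinearMap.sub_apply, hfx]
      obtain ⟨k, hk⟩ := Nat.exists_eq_add_of_le' hd1
      rw [hG, LinearMap.mem_ker, hk, pow_succ, Module.End.mul_apply, h2, map_zero]
    have : Nontrivial (G i) := ⟨⟨⟨x, hxG⟩, 0, by simpa [Subtype.ext_iff] using hx0⟩⟩
    exact Module.finrank_pos
  · rw [hmemH] at hh ⊢
    rw [hcomm, hh, map_zero]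

/-- A decomposition at level `r` provides a compact operator `Q` such that the powers of `T`
are geometrically small modulo right multiples of `Q`. -/
theorem QCDecomposition.exists_isCompactOperator [CompleteSpace E] {T : E →L[ℂ] E} {r : ℝ}
    (h : QCDecomposition T r) : ∃ (Q : E →L[ℂ] E) (n : ℕ) (s C : ℝ), IsCompactOperator Q ∧ 1 ≤ n ∧
      0 ≤ s ∧ s < r ∧ ∀ k : ℕ, ‖T ^ (n * k) - T ^ (n * k) * Q‖ ≤ C * s ^ (n * k) := by
  obtain ⟨m, lam, p, H, -, -, hint, -, hdim, hcl, hinv, hlt⟩ := h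
  set G : Fin m → Submodule ℂ E := fun i =>
    LinearMap.ker (((T : E →ₗ[ℂ] E) - lam i • LinearMap.id) ^ p i) with hG
  obtain ⟨hindep, htop⟩ := (DirectSum.isInternal_submodule_iff_iSupIndep_and_iSup_eq_top _).1 hint
  have hfin : ∀ i, FiniteDimensional ℂ (G i) := fun i => (hdim i).1
  set F := ⨆ i, G i with hF
  have hFH : IsCompl F H := by
    constructor
    · refine (Disjoint.mono_right ?_ (hindep none)).symm
      exact iSup_le fun i => le_iSup₂_of_le (some i) (by simp) le_rfl
    · rw [codisjoint_iff, sup_comm, ← htop, iSup_option]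
      rfl
  -- The projection along `H` is bounded because `F` is finite-dimensional and `H` is closed.
  set g := F.projectionOntoL H
    (Submodule.IsCompl.isTopCompl_of_isClosed hFH F.closed_of_finiteDimensional hcl) with hg
  set Q : E →L[ℂ] E := F.subtypeL ∘L g with hQ
  have hQH : ∀ x, x - Q x ∈ H := fun x => by
    rw [← Submodule.projectionOntoL_apply_eq_zero_iff
      (Submodule.IsCompl.isTopCompl_of_isClosed hFH F.closed_of_finiteDimensional hcl), map_sub]
    change g x - g (g x : E) = 0
    rw [hg, Submodule.projectionOntoL_apply_left, sub_self]
  obtain ⟨_, ⟨n, hn, rfl⟩, hs⟩ := exists_lt_of_csInf_lt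
    (by exact ⟨_, 1, le_rfl, rfl⟩) hlt
  set A := ⨆ h : {h : E // h ∈ H ∧ ‖h‖ ≤ 1}, ‖(T ^ n) (h : E)‖ with hA
  have hA0 : 0 ≤ A := Real.iSup_nonneg fun _ => norm_nonneg _
  have hinvn : ∀ (n : ℕ), ∀ x ∈ H, (T ^ n) x ∈ H := fun n x hx => by
    have := pow_mem_of_le_comap (f := (T : E →ₗ[ℂ] E)) (W := H) (fun y hy => hinv y hy) hx n
    rwa [coe_pow_apply] at this
  have hAx : ∀ x ∈ H, ‖(T ^ n) x‖ ≤ A * ‖x‖ := fun x hx => by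
    rcases eq_or_ne x 0 with rfl | hx0
    · simp
    have hx0' : 0 < ‖x‖ := norm_pos_iff.2 hx0
    have h1 := le_ciSup (bddAbove_norm_apply (T ^ n) H) ⟨((‖x‖⁻¹ : ℝ) : ℂ) • x,
      H.smul_mem _ hx, by
        rw [norm_smul, Complex.norm_real, norm_inv, norm_norm, inv_mul_cancel₀ hx0'.ne']⟩
    simp only [map_smul, norm_smul, Complex.norm_real, norm_inv, norm_norm] at h1
    rw [inv_mul_le_iff₀ hx0'] at h1
    linarith
  have hAk : ∀ k : ℕ, ∀ x ∈ H, ‖(T ^ (n * k)) x‖ ≤ A ^ k * ‖x‖ := by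
    intro k
    induction k with
    | zero => simp
    | succ k ih =>
      intro x hx
      rw [mul_add, mul_one, add_comm, pow_add, mul_apply_eq_comp]
      calc _ ≤ A * ‖(T ^ (n * k)) x‖ := hAx _ (hinvn _ x hx)
        _ ≤ A * (A ^ k * ‖x‖) := by gcongr; exact ih x hx
        _ = _ := by ring
  -- The rate `s = A^(1/n)` satisfies `s^(n k) = A^k`, the bound for `T^(n k)` on `H`.
  refine ⟨Q, n, A ^ (1 / (n : ℝ)), ‖(1 - Q : E →L[ℂ] E)‖, isCompactOperator_subtypeL_comp g, hn,
    Real.rpow_nonneg hA0 _, hs, fun k => ?_⟩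
  rw [pow_mul (A ^ (1 / (n : ℝ))), one_div, Real.rpow_inv_natCast_pow hA0 (by omega)]
  refine ContinuousLinearMap.opNorm_le_bound _ (by positivity) fun x => ?_
  have h1 : (T ^ (n * k) - T ^ (n * k) * Q) x = (T ^ (n * k)) (x - Q x) := by
    simp [mul_apply_eq_comp]
  rw [h1, mul_right_comm, mul_comm _ (A ^ k)]
  refine (hAk k _ (hQH x)).trans ?_
  gcongr
  exact (1 - Q : E →L[ℂ] E).le_opNorm x

end Quasi

/-! ### The space `B_V` and the iterates of `P` -/

section Space

variable {V : ℕ → Set.Ici (1 : ℝ)}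

/-- The element of `B_V` given by a function dominated by a multiple of `V`. -/
def BV.ofBound (f : ℕ → ℂ) (C : ℝ) (h : ∀ n, ‖f n‖ ≤ C * (V n : ℝ)) : BV V :=
  (⟨f, C, by rintro _ ⟨n, rfl⟩; exact (div_le_iff₀ (V_pos V n)).2 (h n)⟩ : bvSubmodule V)

theorem BV.toFun_ofBound (f : ℕ → ℂ) (C : ℝ) (h : ∀ n, ‖f n‖ ≤ C * (V n : ℝ)) (n : ℕ) :
    (BV.ofBound f C h).toFun n = f n := rfl

/-- Evaluation at a point. -/
def BV.eval (V : ℕ → Set.Ici (1 : ℝ)) (n : ℕ) : BV V →L[ℂ] ℂ :=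
  LinearMap.mkContinuous
    { toFun := fun f => f.toFun n
      map_add' := fun f g => BV.toFun_add f g n
      map_smul' := fun c f => BV.toFun_smul c f n }
    (V n) fun f => by rw [mul_comm]; exact f.norm_toFun_le n

theorem BV.eval_apply (f : BV V) (n : ℕ) : BV.eval V n f = f.toFun n := rfl

theorem BV.toFun_sub (f g : BV V) (n : ℕ) : (f - g).toFun n = f.toFun n - g.toFun n :=
  map_sub (BV.eval V n) f g

theorem BV.toFun_sum {ι : Type*} (s : Finset ι) (f : ι → BV V) (n : ℕ) :
    (∑ i ∈ s, f i).toFun n = ∑ i ∈ s, (f i).toFun n :=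
  map_sum (BV.eval V n) f s

instance : CompleteSpace (BV V) := by
  refine Metric.complete_of_cauchySeq_tendsto fun u hu => ?_
  have hlim : ∀ n, ∃ a, Tendsto (fun k => (u k).toFun n) atTop (𝓝 a) := fun n =>
    cauchySeq_tendsto_of_complete ((BV.eval V n).uniformContinuous.comp_cauchySeq hu)
  choose g hg using hlim
  obtain ⟨M, hM⟩ := hu.norm_bddAbove
  have hgM : ∀ n, ‖g n‖ ≤ M * (V n : ℝ) := fun n =>
    le_of_tendsto (hg n).norm (Eventually.of_forall fun k => ((u k).norm_toFun_le n).trans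
      (mul_le_mul_of_nonneg_right (hM ⟨k, rfl⟩) (V_pos V n).le))
  refine ⟨BV.ofBound g M hgM, Metric.tendsto_atTop.2 fun ε hε => ?_⟩
  obtain ⟨K, hK⟩ := Metric.cauchySeq_iff.1 hu (ε / 2) (by positivity)
  refine ⟨K, fun k hk => ?_⟩
  rw [dist_eq_norm]
  refine lt_of_le_of_lt (BV.norm_le (C := ε / 2) fun n => ?_) (by linarith)
  rw [BV.toFun_sub, BV.toFun_ofBound]
  refine le_of_tendsto ((tendsto_const_nhds.sub (hg n)).norm) ?_
  filter_upwards [eventually_ge_atTop K] with l hl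
  rw [← BV.toFun_sub]
  refine ((u k - u l).norm_toFun_le n).trans ?_
  have := (hK k hk l hl).le
  rw [dist_eq_norm] at this
  exact mul_le_mul_of_nonneg_right this (V_pos V n).le

end Space

/-! ### Iterates of `P` on `V` and on `B_V` -/

section Iterates

variable {P : ℕ → ℕ → ℝ} {V : ℕ → Set.Ici (1 : ℝ)}

theorem iterV_zero (n : ℕ) : iterV P V 0 n = V n := rfl

theorem iterV_succ (N n : ℕ) : iterV P V (N + 1) n = ∑' j, P n j * iterV P V N j := by
  rw [iterV, Function.iterate_succ_apply']; rfl

theorem iterV_nonneg (hP : IsMarkov P) (N n : ℕ) : 0 ≤ iterV P V N n := by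
  induction N generalizing n with
  | zero => exact (V_pos V n).le
  | succ N ih =>
    rw [iterV_succ]
    exact tsum_nonneg fun j => mul_nonneg (hP.1 n j) (ih j)

theorem exists_iterV_le (hP : IsMarkov P) (hPV : DriftBounded P V) :
    ∃ M : ℝ, 1 ≤ M ∧ ∀ N n, iterV P V N n ≤ M ^ N * (V n : ℝ) := by
  set M := max (⨆ n, iterV P V 1 n / (V n : ℝ)) 1
  have h1 : ∀ n, iterV P V 1 n ≤ M * (V n : ℝ) := fun n =>
    (div_le_iff₀ (V_pos V n)).1 ((le_ciSup hPV.2 n).trans (le_max_left _ _))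
  refine ⟨M, le_max_right _ _, fun N => ?_⟩
  have hM : 0 ≤ M := zero_le_one.trans (le_max_right _ _)
  induction N with
  | zero => simp [iterV_zero]
  | succ N ih =>
    intro n
    have h2 : ∀ j, P n j * iterV P V N j ≤ M ^ N * (P n j * (V j : ℝ)) := fun j => by
      have := mul_le_mul_of_nonneg_left (ih j) (hP.1 n j)
      linarith
    have hs := (hPV.1 n).mul_left (M ^ N)
    have hs' : Summable fun j => P n j * iterV P V N j :=
      hs.of_nonneg_of_le (fun j => mul_nonneg (hP.1 n j) (iterV_nonneg hP N j)) h2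
    rw [iterV_succ]
    calc ∑' j, P n j * iterV P V N j ≤ ∑' j, M ^ N * (P n j * (V j : ℝ)) := hs'.tsum_le_tsum h2 hs
      _ = M ^ N * iterV P V 1 n := by rw [tsum_mul_left, iterV_succ]; rfl
      _ ≤ M ^ N * (M * (V n : ℝ)) := by gcongr; exact h1 n
      _ = _ := by ring

theorem summable_mul_iterV (hP : IsMarkov P) (hPV : DriftBounded P V) (N n : ℕ) :
    Summable fun j => P n j * iterV P V N j := by
  obtain ⟨M, -, hM⟩ := exists_iterV_le hP hPV
  refine ((hPV.1 n).mul_left (M ^ N)).of_nonneg_of_le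
    (fun j => mul_nonneg (hP.1 n j) (iterV_nonneg hP N j)) fun j => ?_
  have := mul_le_mul_of_nonneg_left (hM N j) (hP.1 n j)
  linarith

theorem hasSum_mul_add (hP : IsMarkov P) (hPV : DriftBounded P V) (N n : ℕ) (a b : ℝ) :
    HasSum (fun j => P n j * (a * iterV P V N j + b)) (a * iterV P V (N + 1) n + b) := by
  have h1 := ((summable_mul_iterV hP hPV N n).hasSum.mul_left a).add ((hP.2 n).mul_right b)
  rw [← iterV_succ, one_mul] at h1
  refine h1.congr_fun fun j => ?_
  ring

/-- Apply `P^N` to the inequality: `P` is positive and preserves constants. -/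
theorem iterV_add_le (hP : IsMarkov P) (hPV : DriftBounded P V) {m : ℕ} {a b : ℝ}
    (h : ∀ n, iterV P V m n ≤ a * (V n : ℝ) + b) (N n : ℕ) :
    iterV P V (N + m) n ≤ a * iterV P V N n + b := by
  induction N generalizing n with
  | zero => simpa [iterV_zero] using h n
  | succ N ih =>
    rw [add_right_comm, iterV_succ]
    have h1 := hasSum_mul_add hP hPV N n a b
    rw [← h1.tsum_eq]
    exact (summable_mul_iterV hP hPV _ n).tsum_le_tsum
      (fun j => mul_le_mul_of_nonneg_left (ih j) (hP.1 n j)) h1.summable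

/-- The constant `d / (1 - δ^N)` is the fixed point of `b ↦ δ^N b + d`. -/
theorem iterV_mul_le (hP : IsMarkov P) (hPV : DriftBounded P V) {N : ℕ} (hN : 1 ≤ N) {d δ : ℝ}
    (hd : 0 < d) (hδ : 0 < δ) (hδ1 : δ < 1)
    (h : ∀ n, iterV P V N n ≤ δ ^ N * (V n : ℝ) + d) (k n : ℕ) :
    iterV P V (N * k) n ≤ δ ^ (N * k) * (V n : ℝ) + d / (1 - δ ^ N) := by
  have h1 : 0 < 1 - δ ^ N := sub_pos.2 (pow_lt_one₀ hδ.le hδ1 (by omega))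
  induction k with
  | zero => simpa [iterV_zero] using (div_pos hd h1).le
  | succ k ih =>
    rw [mul_add, mul_one]
    calc iterV P V (N * k + N) n ≤ δ ^ N * iterV P V (N * k) n + d := iterV_add_le hP hPV h _ n
      _ ≤ δ ^ N * (δ ^ (N * k) * (V n : ℝ) + d / (1 - δ ^ N)) + d := by gcongr
      _ = _ := by rw [pow_add]; field_simp; ring

theorem exists_iterV_le_of_weakDrift (hP : IsMarkov P) (hPV : DriftBounded P V)
    (hW : WeakDrift P V) : ∃ C : ℝ, 0 ≤ C ∧ ∀ N n, iterV P V N n ≤ C * (V n : ℝ) := by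
  obtain ⟨N, hN, d, hd, δ, hδ, hδ1, h⟩ := hW
  obtain ⟨M, hM1, hM⟩ := exists_iterV_le hP hPV
  set D := d / (1 - δ ^ N) with hD
  have hD0 : 0 ≤ D := div_nonneg hd.le (sub_nonneg.2 (pow_le_one₀ hδ.le hδ1.le))
  -- Divide `m` by `N`: the remainder costs at most `M^N`, and `V ≥ 1` absorbs the additive constant
  -- `D`.
  refine ⟨M ^ N * (1 + D), by positivity, fun m n => ?_⟩
  have hV1 : (1 : ℝ) ≤ V n := (V n).2
  have h1 := iterV_add_le hP hPV (m := m % N) (a := M ^ (m % N)) (b := 0)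
    (by simpa using hM (m % N)) (N * (m / N)) n
  rw [Nat.div_add_mod, add_zero] at h1
  have h2 : iterV P V (N * (m / N)) n ≤ (1 + D) * (V n : ℝ) := by
    have h3 := iterV_mul_le hP hPV hN hd hδ hδ1 h (m / N) n
    have h4 : δ ^ (N * (m / N)) ≤ 1 := pow_le_one₀ hδ.le hδ1.le
    nlinarith
  calc _ ≤ _ := h1
    _ ≤ M ^ N * ((1 + D) * (V n : ℝ)) := by
      gcongr
      · exact iterV_nonneg hP _ _
      · exact (Nat.mod_lt _ hN).le
    _ = _ := by ring

variable (hP : IsMarkov P) (hPV : DriftBounded P V)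

theorem norm_pow_opBV_apply_le {f : BV V} {a b : ℝ} (h : ∀ n, ‖f.toFun n‖ ≤ a * (V n : ℝ) + b)
    (N n : ℕ) : ‖((opBV P V hP hPV ^ N) f).toFun n‖ ≤ a * iterV P V N n + b := by
  induction N generalizing n with
  | zero => simpa [iterV_zero] using h n
  | succ N ih =>
    rw [pow_succ', mul_apply_eq_comp, opBV_apply]
    refine (norm_tsum_le_tsum_norm (summable_norm_act hP hPV _ n)).trans ?_
    have h1 := hasSum_mul_add hP hPV N n a b
    rw [← h1.tsum_eq]
    refine (summable_norm_act hP hPV _ n).tsum_le_tsum (fun j => ?_) h1.summable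
    rw [norm_smul, Real.norm_of_nonneg (hP.1 n j)]
    exact mul_le_mul_of_nonneg_left (ih j) (hP.1 n j)

theorem norm_pow_opBV_apply_le_norm_mul (f : BV V) (N n : ℕ) :
    ‖((opBV P V hP hPV ^ N) f).toFun n‖ ≤ ‖f‖ * iterV P V N n := by
  simpa using norm_pow_opBV_apply_le hP hPV (f := f) (a := ‖f‖) (b := 0)
    (by simpa using f.norm_toFun_le) N n

theorem powerBounded_opBV (hW : WeakDrift P V) : PowerBounded (opBV P V hP hPV) := by
  obtain ⟨C, hC0, hC⟩ := exists_iterV_le_of_weakDrift hP hPV hW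
  refine ⟨C, fun N _ => ContinuousLinearMap.opNorm_le_bound _ hC0 fun f => BV.norm_le fun n => ?_⟩
  calc _ ≤ ‖f‖ * iterV P V N n := norm_pow_opBV_apply_le_norm_mul hP hPV f N n
    _ ≤ ‖f‖ * (C * (V n : ℝ)) := by gcongr; exact hC N n
    _ = _ := by ring

/-- The weight `V` as an element of `B_V`. -/
def weightBV (V : ℕ → Set.Ici (1 : ℝ)) : BV V :=
  BV.ofBound (fun n => ((V n : ℝ) : ℂ)) 1 fun n => by
    rw [Complex.norm_real, Real.norm_of_nonneg (V_pos V n).le, one_mul]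

theorem pow_opBV_weightBV (N n : ℕ) :
    ((opBV P V hP hPV ^ N) (weightBV V)).toFun n = (iterV P V N n : ℂ) := by
  induction N generalizing n with
  | zero => rfl
  | succ N ih =>
    rw [pow_succ', mul_apply_eq_comp, opBV_apply, iterV_succ, Complex.ofReal_tsum]
    refine tsum_congr fun j => ?_
    rw [ih, Complex.real_smul, Complex.ofReal_mul]

/-- The constant function `1` as an element of `B_V`. -/
def oneBV (V : ℕ → Set.Ici (1 : ℝ)) : BV V :=
  BV.ofBound (fun _ => 1) 1 fun n => by
    rw [norm_one, one_mul]; exact (V n).2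

theorem oneBV_ne_zero : oneBV V ≠ 0 := fun h => by
  have : (oneBV V).toFun 0 = (0 : BV V).toFun 0 := by rw [h]
  exact one_ne_zero (α := ℂ) this

theorem opBV_oneBV : opBV P V hP hPV (oneBV V) = oneBV V := BV.ext fun n => by
  rw [opBV_apply]
  change ∑' j, P n j • (1 : ℂ) = 1
  have h1 := Complex.hasSum_ofReal.2 (hP.2 n)
  simpa using h1.tsum_eq

end Iterates

/-! ### The quantities `ℓ_N`, `L` and `δ_V(P)` -/

section Drift

variable {P : ℕ → ℕ → ℝ} {V : ℕ → Set.Ici (1 : ℝ)}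

theorem isBoundedUnder_ratio (hP : IsMarkov P) (hPV : DriftBounded P V) (N : ℕ) :
    IsBoundedUnder (· ≤ ·) atTop fun n => iterV P V N n / (V n : ℝ) := by
  obtain ⟨M, -, hM⟩ := exists_iterV_le hP hPV
  exact isBoundedUnder_of ⟨M ^ N, fun n => (div_le_iff₀ (V_pos V n)).2 (hM N n)⟩

theorem isCoboundedUnder_ratio (hP : IsMarkov P) (N : ℕ) :
    IsCoboundedUnder (· ≤ ·) atTop fun n => iterV P V N n / (V n : ℝ) :=
  (isBoundedUnder_of ⟨0, fun n => div_nonneg (iterV_nonneg hP N n) (V_pos V n).le⟩ :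
    IsBoundedUnder (· ≥ ·) atTop _).isCoboundedUnder_le

theorem ell_nonneg (hP : IsMarkov P) (hPV : DriftBounded P V) (N : ℕ) : 0 ≤ ell P V N :=
  le_limsup_of_frequently_le
    (Frequently.of_forall fun n => div_nonneg (iterV_nonneg hP N n) (V_pos V n).le)
    (isBoundedUnder_ratio hP hPV N)

theorem ell_le_of_le (hP : IsMarkov P)
    (hV : Tendsto (fun n => (V n : ℝ)) atTop atTop) {N : ℕ} {c d : ℝ}
    (h : ∀ n, iterV P V N n ≤ c * (V n : ℝ) + d) : ell P V N ≤ c := by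
  have hlim : Tendsto (fun n => c + d / (V n : ℝ)) atTop (𝓝 c) := by
    simpa using (tendsto_const_nhds (x := c)).add (hV.const_div_atTop d)
  rw [← hlim.limsup_eq]
  refine limsup_le_limsup (Eventually.of_forall fun n => ?_) (isCoboundedUnder_ratio hP N)
    hlim.isBoundedUnder_le
  rw [div_le_iff₀ (V_pos V n), add_mul, div_mul_cancel₀ _ (V_pos V n).ne']
  exact h n

theorem exists_le_of_ell_lt (hP : IsMarkov P) (hPV : DriftBounded P V) {N : ℕ} {c : ℝ}
    (h : ell P V N < c) : ∃ d : ℝ, 0 < d ∧ ∀ n, iterV P V N n ≤ c * (V n : ℝ) + d := by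
  have hev := eventually_lt_of_limsup_lt h (isBoundedUnder_ratio hP hPV N)
  obtain ⟨n₀, hn₀⟩ := eventually_atTop.1 hev
  have hc : 0 ≤ c := (ell_nonneg hP hPV N).trans h.le
  have hsum : 0 ≤ ∑ i ∈ Finset.range n₀, iterV P V N i :=
    Finset.sum_nonneg fun i _ => iterV_nonneg hP N i
  -- The sum dominates the finitely many exceptional values; the `+ 1` makes `d` positive.
  refine ⟨∑ i ∈ Finset.range n₀, iterV P V N i + 1, by linarith, fun n => ?_⟩
  have hcV : 0 ≤ c * (V n : ℝ) := mul_nonneg hc (V_pos V n).le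
  rcases lt_or_ge n n₀ with hn | hn
  · have := Finset.single_le_sum (f := fun i => iterV P V N i)
      (fun i _ => iterV_nonneg hP N i) (Finset.mem_range.2 hn)
    linarith
  · have := (div_lt_iff₀ (V_pos V n)).1 (hn₀ n hn)
    linarith

theorem bddBelow_bigL (hP : IsMarkov P) (hPV : DriftBounded P V) :
    BddBelow {x : ℝ | ∃ N : ℕ, 1 ≤ N ∧ x = ell P V N ^ (1 / (N : ℝ))} :=
  ⟨0, by rintro _ ⟨N, -, rfl⟩; exact Real.rpow_nonneg (ell_nonneg hP hPV N) _⟩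

theorem bigL_nonneg (hP : IsMarkov P) (hPV : DriftBounded P V) : 0 ≤ bigL P V :=
  le_csInf ⟨_, 1, le_rfl, rfl⟩ (by
    rintro _ ⟨N, -, rfl⟩; exact Real.rpow_nonneg (ell_nonneg hP hPV N) _)

theorem bigL_le_of_ell_le (hP : IsMarkov P) (hPV : DriftBounded P V) {N : ℕ} (hN : 1 ≤ N) {δ : ℝ}
    (hδ : 0 ≤ δ) (h : ell P V N ≤ δ ^ N) : bigL P V ≤ δ := by
  refine (csInf_le (bddBelow_bigL hP hPV) ⟨N, hN, rfl⟩).trans ?_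
  calc _ ≤ (δ ^ N) ^ (1 / (N : ℝ)) :=
        Real.rpow_le_rpow (ell_nonneg hP hPV N) h (by positivity)
    _ = δ := by rw [one_div, Real.pow_rpow_inv_natCast hδ (by omega)]

theorem exists_drift_of_bigL_lt (hP : IsMarkov P) (hPV : DriftBounded P V) {r : ℝ}
    (h : bigL P V < r) : ∃ N : ℕ, 1 ≤ N ∧ ∃ d : ℝ, 0 < d ∧ ∃ δ : ℝ, 0 < δ ∧ δ < r ∧
      ∀ n, iterV P V N n ≤ δ ^ N * (V n : ℝ) + d := by
  obtain ⟨_, ⟨N, hN, rfl⟩, hlt⟩ := exists_lt_of_csInf_lt (by exact ⟨_, 1, le_rfl, rfl⟩) h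
  have h0 := ell_nonneg hP hPV N
  obtain ⟨δ, hδ1, hδ2⟩ := exists_between hlt
  have hδ0 : 0 < δ := (Real.rpow_nonneg h0 _).trans_lt hδ1
  have hell : ell P V N < δ ^ N := by
    have := pow_lt_pow_left₀ hδ1 (Real.rpow_nonneg h0 _) (n := N) (by omega)
    rwa [one_div, Real.rpow_inv_natCast_pow h0 (by omega)] at this
  obtain ⟨d, hd, hle⟩ := exists_le_of_ell_lt hP hPV hell
  exact ⟨N, hN, d, hd, δ, hδ0, hδ2, hle⟩

theorem weakDrift_iff_bigL_lt_one (hP : IsMarkov P)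
    (hV : Tendsto (fun n => (V n : ℝ)) atTop atTop) (hPV : DriftBounded P V) :
    WeakDrift P V ↔ bigL P V < 1 := by
  constructor
  · rintro ⟨N, hN, d, -, δ, hδ, hδ1, h⟩
    exact (bigL_le_of_ell_le hP hPV hN hδ.le (ell_le_of_le hP hV h)).trans_lt hδ1
  · exact exists_drift_of_bigL_lt hP hPV

theorem deltaV_eq_bigL (hP : IsMarkov P) (hV : Tendsto (fun n => (V n : ℝ)) atTop atTop)
    (hPV : DriftBounded P V) (hL : bigL P V < 1) : deltaV P V = bigL P V := by
  refine le_antisymm ?_ ?_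
  · by_contra! hlt
    -- Staying below 1 as well makes the rate `δ` admissible in `deltaV`.
    obtain ⟨N, hN, d, hd, δ, hδ, hδr, h⟩ := exists_drift_of_bigL_lt hP hPV (lt_min hlt hL)
    have : deltaV P V ≤ δ := csInf_le ⟨0, fun x hx => hx.1⟩
      ⟨hδ.le, hδr.trans_le (min_le_right _ _), N, hN, d, hd, h⟩
    exact absurd (hδr.trans_le (min_le_left _ _)) (not_lt.2 this)
  · obtain ⟨N, hN, d, hd, δ, hδ, hδr, h⟩ := exists_drift_of_bigL_lt hP hPV hL
    refine le_csInf ⟨δ, hδ.le, hδr, N, hN, d, hd, h⟩ ?_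
    rintro δ ⟨hδ, -, N, hN, d, -, h⟩
    exact bigL_le_of_ell_le hP hPV hN hδ (ell_le_of_le hP hV h)

end Drift

/-! ### Quasi-compactness above `L` -/

section Upper

variable {P : ℕ → ℕ → ℝ} {V : ℕ → Set.Ici (1 : ℝ)}

/-- The indicator of a point as an element of `B_V`. -/
def diracBV (V : ℕ → Set.Ici (1 : ℝ)) (i : ℕ) : BV V :=
  BV.ofBound (fun n => if n = i then 1 else 0) 1 fun n => by
    have : (1 : ℝ) ≤ V n := (V n).2
    split_ifs
    · simpa
    · rw [norm_zero]; linarith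

/-- Restriction to the first `a` coordinates. -/
def cutBV (V : ℕ → Set.Ici (1 : ℝ)) (a : ℕ) : BV V →L[ℂ] BV V :=
  ∑ i ∈ Finset.range a, (BV.eval V i).smulRight (diracBV V i)

theorem isCompactOperator_cutBV (a : ℕ) : IsCompactOperator (cutBV V a) := by
  have h1 : ∀ i, (BV.eval V i).smulRight (diracBV V i) ∈
      compactOperator (RingHom.id ℂ) (BV V) (BV V) := fun i => by
    have h2 : IsCompactOperator (BV.eval V i) := isCompactOperator_of_locallyCompactSpace_dom _
    exact h2.clm_comp (ContinuousLinearMap.toSpanSingleton ℂ (diracBV V i))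
  exact Submodule.sum_mem _ fun i _ => h1 i

theorem toFun_cutBV (a : ℕ) (f : BV V) (n : ℕ) :
    (cutBV V a f).toFun n = if n < a then f.toFun n else 0 := by
  have h1 : cutBV V a f = ∑ i ∈ Finset.range a, f.toFun i • diracBV V i := by
    simp [cutBV, BV.eval_apply]
  rw [h1, BV.toFun_sum]
  simp only [BV.toFun_smul, diracBV, BV.toFun_ofBound, mul_ite, mul_one, mul_zero]
  rw [Finset.sum_ite_eq]
  simp

/-- Beyond the first `a` coordinates `d ≤ c V`, hence `P^N V ≤ 2 c V`. Cutting there leaves a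
compact part and a small rest. -/
theorem exists_pow_opBV_eq_add (hP : IsMarkov P)
    (hV : Tendsto (fun n => (V n : ℝ)) atTop atTop) (hPV : DriftBounded P V) {N : ℕ} {c d : ℝ}
    (hc : 0 < c) (h : ∀ n, iterV P V N n ≤ c * (V n : ℝ) + d) :
    ∃ K R : BV V →L[ℂ] BV V, opBV P V hP hPV ^ N = K + R ∧ IsCompactOperator K ∧
      ‖R‖ ≤ 2 * c := by
  obtain ⟨a, ha⟩ := eventually_atTop.1 (hV.eventually_ge_atTop (d / c))
  refine ⟨cutBV V a ∘L opBV P V hP hPV ^ N,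
    opBV P V hP hPV ^ N - cutBV V a ∘L opBV P V hP hPV ^ N, by abel,
    (isCompactOperator_cutBV a).comp_clm _,
    ContinuousLinearMap.opNorm_le_bound _ (by positivity) fun f => BV.norm_le fun n => ?_⟩
  simp only [sub_apply, ContinuousLinearMap.comp_apply, BV.toFun_sub, toFun_cutBV]
  have hVn := V_pos V n
  split_ifs with hn
  · rw [sub_self, norm_zero]
    positivity
  · rw [sub_zero]
    have h1 : d ≤ c * (V n : ℝ) := by
      have := ha n (not_lt.1 hn)
      rwa [div_le_iff₀ hc, mul_comm] at this
    calc _ ≤ ‖f‖ * iterV P V N n := norm_pow_opBV_apply_le_norm_mul hP hPV f N n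
      _ ≤ ‖f‖ * (2 * c * (V n : ℝ)) := by
        gcongr
        linarith [h n]
      _ = _ := by ring

theorem qcDecomposition_of_bigL_lt (hP : IsMarkov P)
    (hV : Tendsto (fun n => (V n : ℝ)) atTop atTop) (hPV : DriftBounded P V) {r : ℝ}
    (hL : bigL P V < r) (hr1 : r < 1) : QCDecomposition (opBV P V hP hPV) r := by
  have hr : 0 < r := (bigL_nonneg hP hPV).trans_lt hL
  obtain ⟨N, hN, d, hd, δ, hδ, hδr, h⟩ := exists_drift_of_bigL_lt hP hPV hL
  have hq0 : 0 ≤ (δ / r) ^ N := by positivity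
  have hq1 : (δ / r) ^ N < 1 := pow_lt_one₀ (by positivity) ((div_lt_one hr).2 hδr) (by omega)
  -- The factor 8 combines `‖R‖ ≤ 2c` with the requirement `4 ‖R‖ < r^(N k)`.
  obtain ⟨k, hk⟩ := exists_pow_lt_of_lt_one (show (0 : ℝ) < 1 / 8 by norm_num) hq1
  rw [← pow_mul, div_pow, div_lt_iff₀ (by positivity)] at hk
  obtain ⟨K, R, hKR, hK, hR⟩ := exists_pow_opBV_eq_add hP hV hPV (pow_pos hδ (N * k))
    (iterV_mul_le hP hPV hN hd hδ (hδr.trans hr1) h k)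
  refine qcDecomposition_of_pow_eq_add hr hKR hK (by linarith) (z := 1) (by simpa using hr1.le)
    oneBV_ne_zero ?_
  rw [opBV_oneBV, one_smul]

end Upper

/-! ### The distance of `P^N` to the compact operators is at least `ℓ_N` -/

section Lower

variable {P : ℕ → ℕ → ℝ} {V : ℕ → Set.Ici (1 : ℝ)}

/-- The restriction of `V` to the first `a` coordinates. -/
def truncV (V : ℕ → Set.Ici (1 : ℝ)) (a n : ℕ) : ℝ := if n < a then (V n : ℝ) else 0

theorem truncV_nonneg (a n : ℕ) : 0 ≤ truncV V a n := by
  unfold truncV; split_ifs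
  exacts [(V_pos V n).le, le_rfl]

theorem truncV_le (a n : ℕ) : truncV V a n ≤ V n := by
  unfold truncV; split_ifs
  exacts [le_rfl, (V_pos V n).le]

theorem truncV_mono {a b : ℕ} (h : a ≤ b) (n : ℕ) : truncV V a n ≤ truncV V b n := by
  by_cases hn : n < a
  · simp [truncV, hn, hn.trans_le h]
  · rw [truncV, if_neg hn]
    exact truncV_nonneg b n

theorem toFun_cutBV_weightBV (a n : ℕ) :
    (cutBV V a (weightBV V)).toFun n = (truncV V a n : ℂ) := by
  rw [toFun_cutBV, truncV]
  split_ifs <;> simp [weightBV, BV.toFun_ofBound]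

theorem tendsto_pow_opBV_apply (hP : IsMarkov P) (hPV : DriftBounded P V) {F : ℕ → BV V}
    {f : BV V} {C : ℝ} (hC : ∀ b, ‖F b‖ ≤ C)
    (hF : ∀ n, Tendsto (fun b => (F b).toFun n) atTop (𝓝 (f.toFun n))) (N n : ℕ) :
    Tendsto (fun b => ((opBV P V hP hPV ^ N) (F b)).toFun n) atTop
      (𝓝 (((opBV P V hP hPV ^ N) f).toFun n)) := by
  induction N generalizing n with
  | zero => exact hF n
  | succ N ih =>
    simp only [pow_succ', mul_apply_eq_comp, opBV_apply]
    refine tendsto_tsum_of_dominated_convergence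
      (bound := fun j => C * (P n j * iterV P V N j)) ((summable_mul_iterV hP hPV N n).mul_left C)
      (fun j => (ih j).const_smul _) (Eventually.of_forall fun b j => ?_)
    rw [norm_smul, Real.norm_of_nonneg (hP.1 n j)]
    calc _ ≤ P n j * (‖F b‖ * iterV P V N j) :=
          mul_le_mul_of_nonneg_left (norm_pow_opBV_apply_le_norm_mul hP hPV _ N j) (hP.1 n j)
      _ ≤ P n j * (C * iterV P V N j) := by
          gcongr
          exacts [hP.1 n j, iterV_nonneg hP N j, hC b]
      _ = _ := by ring

theorem norm_cutBV_weightBV_le (a : ℕ) : ‖cutBV V a (weightBV V)‖ ≤ 1 := by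
  refine BV.norm_le fun n => ?_
  rw [toFun_cutBV_weightBV, Complex.norm_real, Real.norm_of_nonneg (truncV_nonneg a n), one_mul]
  exact truncV_le a n

/-- Choose `x` with `P^N V(x) > c₁ V(x)` and `V(x)` large. The first `a` coordinates contribute at
most the constant `M` to `P^N V(x)`, and dominated convergence lets a finite `b` replace the full
weight. -/
theorem exists_le_norm_pow_opBV_block (hP : IsMarkov P)
    (hV : Tendsto (fun n => (V n : ℝ)) atTop atTop) (hPV : DriftBounded P V) {N : ℕ} {c : ℝ}
    (hc : c < ell P V N) (a : ℕ) : ∃ b, a ≤ b ∧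
      c ≤ ‖(opBV P V hP hPV ^ N) (cutBV V b (weightBV V) - cutBV V a (weightBV V))‖ := by
  obtain ⟨c₁, hc₁, hc₁'⟩ := exists_between hc
  have hfreq := frequently_lt_of_lt_limsup (isCoboundedUnder_ratio hP N) hc₁'
  set M := ∑ j ∈ Finset.range a, (V j : ℝ) with hM
  have hcut : ∀ n, ‖(cutBV V a (weightBV V)).toFun n‖ ≤ 0 * (V n : ℝ) + M := fun n => by
    rw [toFun_cutBV_weightBV, Complex.norm_real, Real.norm_of_nonneg (truncV_nonneg a n), zero_mul,
      zero_add, truncV]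
    split_ifs with hn
    · exact Finset.single_le_sum (f := fun j => (V j : ℝ)) (fun j _ => (V_pos V j).le)
        (Finset.mem_range.2 hn)
    · exact Finset.sum_nonneg fun j _ => (V_pos V j).le
  obtain ⟨x, hx, hxM⟩ := (hfreq.and_eventually
    (hV.eventually_ge_atTop (M / (c₁ - c)))).exists
  rw [lt_div_iff₀ (V_pos V x)] at hx
  rw [div_le_iff₀ (sub_pos.2 hc₁)] at hxM
  have hlim : Tendsto (fun b => ‖((opBV P V hP hPV ^ N) (cutBV V b (weightBV V))).toFun x‖) atTop
      (𝓝 (iterV P V N x)) := by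
    have h1 := (tendsto_pow_opBV_apply hP hPV (F := fun b => cutBV V b (weightBV V))
      (f := weightBV V) norm_cutBV_weightBV_le (fun n => ?_) N x).norm
    · rwa [pow_opBV_weightBV, Complex.norm_real, Real.norm_of_nonneg (iterV_nonneg hP N x)] at h1
    · refine tendsto_const_nhds.congr' ?_
      filter_upwards [eventually_gt_atTop n] with b hb
      rw [toFun_cutBV, if_pos hb]
  obtain ⟨b, hb, hab⟩ := ((hlim.eventually (lt_mem_nhds hx)).and (eventually_ge_atTop a)).exists
  refine ⟨b, hab, ?_⟩
  have h2 := norm_pow_opBV_apply_le hP hPV hcut N x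
  rw [zero_mul, zero_add] at h2
  have h3 := BV.norm_toFun_le
    ((opBV P V hP hPV ^ N) (cutBV V b (weightBV V) - cutBV V a (weightBV V))) x
  rw [map_sub, BV.toFun_sub] at h3
  have h4 := norm_sub_norm_le (((opBV P V hP hPV ^ N) (cutBV V b (weightBV V))).toFun x)
    (((opBV P V hP hPV ^ N) (cutBV V a (weightBV V))).toFun x)
  rw [map_sub]
  by_contra! hlt
  have h5 := mul_lt_mul_of_pos_right hlt (V_pos V x)
  linarith

theorem norm_sum_smul_block_le {a : ℕ → ℕ} (ha : Monotone a) {c : ℕ → ℂ} (hc : ∀ k, ‖c k‖ ≤ 1)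
    (K : ℕ) : ‖∑ k ∈ Finset.range K,
      c k • (cutBV V (a (k + 1)) (weightBV V) - cutBV V (a k) (weightBV V))‖ ≤ 1 := by
  refine BV.norm_le fun n => ?_
  rw [BV.toFun_sum, one_mul]
  calc _ ≤ ∑ k ∈ Finset.range K, (truncV V (a (k + 1)) n - truncV V (a k) n) := by
        refine norm_sum_le_of_le _ fun k _ => ?_
        have h1 : 0 ≤ truncV V (a (k + 1)) n - truncV V (a k) n :=
          sub_nonneg.2 (truncV_mono (ha k.le_succ) n)
        rw [BV.toFun_smul, BV.toFun_sub, toFun_cutBV_weightBV, toFun_cutBV_weightBV,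
          ← Complex.ofReal_sub, norm_mul, Complex.norm_real, Real.norm_of_nonneg h1]
        exact mul_le_of_le_one_left h1 (hc k)
    _ = truncV V (a K) n - truncV V (a 0) n :=
        Finset.sum_range_sub (fun k => truncV V (a k) n) K
    _ ≤ _ := by linarith [truncV_le (V := V) (a K) n, truncV_nonneg (V := V) (a 0) n]

/-- The blocks are weakly null: with unimodular coefficients aligning the values of `φ`, partial
sums still have norm at most 1, so the series of `|φ|` on the blocks is bounded by `‖φ‖`. -/
theorem tendsto_apply_block {a : ℕ → ℕ} (ha : Monotone a) (φ : BV V →L[ℂ] ℂ) :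
    Tendsto (fun k => φ (cutBV V (a (k + 1)) (weightBV V) - cutBV V (a k) (weightBV V))) atTop
      (𝓝 0) := by
  set f := fun k => cutBV V (a (k + 1)) (weightBV V) - cutBV V (a k) (weightBV V) with hf
  set c : ℕ → ℂ := fun k => (starRingEnd ℂ) (φ (f k)) / ‖φ (f k)‖ with hc
  have hc1 : ∀ k, ‖c k‖ ≤ 1 := fun k => by
    simp only [hc, norm_div, RCLike.norm_conj, Complex.norm_real, norm_norm]
    exact div_self_le_one _
  have hcφ : ∀ k, c k * φ (f k) = (‖φ (f k)‖ : ℂ) := fun k => by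
    rcases eq_or_ne (φ (f k)) 0 with h0 | h0
    · simp [h0]
    · have : (‖φ (f k)‖ : ℂ) ≠ 0 := by simpa using h0
      rw [hc, div_mul_eq_mul_div, div_eq_iff this, mul_comm, Complex.mul_conj,
        Complex.normSq_eq_norm_sq]
      push_cast; ring
  have hsum : Summable fun k => ‖φ (f k)‖ := by
    refine summable_of_sum_range_le (c := ‖φ‖) (fun _ => norm_nonneg _) fun K => ?_
    have h1 : φ (∑ k ∈ Finset.range K, c k • f k) =
        ((∑ k ∈ Finset.range K, ‖φ (f k)‖ : ℝ) : ℂ) := by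
      rw [map_sum]; push_cast
      exact Finset.sum_congr rfl fun k _ => by rw [map_smul, smul_eq_mul, hcφ]
    have h2 := φ.le_of_opNorm_le_of_le le_rfl (norm_sum_smul_block_le (V := V) ha hc1 K)
    rw [mul_one] at h2
    change ‖φ (∑ k ∈ Finset.range K, c k • f k)‖ ≤ _ at h2
    rw [h1, Complex.norm_real] at h2
    exact (le_abs_self _).trans h2
  exact tendsto_zero_iff_norm_tendsto_zero.2 hsum.tendsto_atTop_zero

theorem ell_le_norm_pow_opBV_sub (hP : IsMarkov P)
    (hV : Tendsto (fun n => (V n : ℝ)) atTop atTop) (hPV : DriftBounded P V) (N : ℕ)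
    {A : BV V →L[ℂ] BV V} (hA : IsCompactOperator A) :
    ell P V N ≤ ‖opBV P V hP hPV ^ N - A‖ := by
  by_contra! hlt
  obtain ⟨c, hc, hc'⟩ := exists_between hlt
  choose b hab hb using exists_le_norm_pow_opBV_block hP hV hPV hc'
  set a : ℕ → ℕ := fun k => b^[k] 0 with ha
  have hasucc : ∀ k, a (k + 1) = b (a k) := fun k => Function.iterate_succ_apply' b k 0
  have hmono : Monotone a := monotone_nat_of_le_succ fun k => by rw [hasucc]; exact hab _
  set f := fun k => cutBV V (a (k + 1)) (weightBV V) - cutBV V (a k) (weightBV V) with hf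
  have hf1 : ∀ k, ‖f k‖ ≤ 1 := fun k => by
    refine BV.norm_le fun n => ?_
    rw [hf, BV.toFun_sub, toFun_cutBV_weightBV, toFun_cutBV_weightBV, ← Complex.ofReal_sub,
      Complex.norm_real, Real.norm_of_nonneg (sub_nonneg.2 (truncV_mono (hmono k.le_succ) n)),
      one_mul]
    linarith [truncV_le (V := V) (a (k + 1)) n, truncV_nonneg (V := V) (a k) n]
  obtain ⟨φ, g, hφ, hg⟩ := exists_seq_tendsto_of_isCompactOperator hA hf1
  -- Each coordinate of `A (f k)` is a continuous functional of the block, so it tends to 0.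
  have hg0 : g = 0 := BV.ext fun n => by
    have h1 := ((BV.eval V n).continuous.tendsto g).comp hg
    have h2 := (tendsto_apply_block hmono (BV.eval V n ∘L A)).comp hφ.tendsto_atTop
    exact tendsto_nhds_unique h1 h2
  have hlow : ∀ k, c - ‖opBV P V hP hPV ^ N - A‖ ≤ ‖A (f k)‖ := fun k => by
    have h1 : c ≤ ‖(opBV P V hP hPV ^ N) (f k)‖ := by
      simp only [hf, hasucc]; exact hb (a k)
    have h2 := (opBV P V hP hPV ^ N - A).le_of_opNorm_le_of_le le_rfl (hf1 k)
    have h3 : (opBV P V hP hPV ^ N) (f k) = (opBV P V hP hPV ^ N - A) (f k) + A (f k) := by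
      simp [sub_apply]
    have h4 := norm_add_le ((opBV P V hP hPV ^ N - A) (f k)) (A (f k))
    rw [← h3] at h4
    linarith
  have h5 := ge_of_tendsto hg.norm (Eventually.of_forall fun k => hlow (φ k))
  rw [hg0, norm_zero] at h5
  linarith

/-- `T^N Q` is compact, so `ℓ_N ≤ ‖T^N - T^N Q‖ ≤ C s^N`. As `s < r`, a large multiple `N` of `n`
absorbs `C`. -/
theorem bigL_le_of_qcDecomposition (hP : IsMarkov P)
    (hV : Tendsto (fun n => (V n : ℝ)) atTop atTop) (hPV : DriftBounded P V) {r : ℝ} (hr : 0 < r)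
    (h : QCDecomposition (opBV P V hP hPV) r) : bigL P V ≤ r := by
  obtain ⟨Q, n, s, C, hQ, hn, hs, hsr, hle⟩ := h.exists_isCompactOperator
  set C' := max C 1
  have hC' : 0 < C' := lt_max_of_lt_right one_pos
  have hq0 : 0 ≤ (s / r) ^ n := by positivity
  have hq1 : (s / r) ^ n < 1 := pow_lt_one₀ (by positivity) ((div_lt_one hr).2 hsr) (by omega)
  obtain ⟨k, hk⟩ := exists_pow_lt_of_lt_one (inv_pos.2 hC') hq1
  have hk' : C' * s ^ (n * (k + 1)) ≤ r ^ (n * (k + 1)) := by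
    have h1 : ((s / r) ^ n) ^ (k + 1) < C'⁻¹ :=
      (pow_le_pow_of_le_one hq0 hq1.le k.le_succ).trans_lt hk
    rw [← pow_mul, div_pow, div_lt_iff₀ (by positivity), inv_mul_eq_div, lt_div_iff₀ hC'] at h1
    linarith
  refine bigL_le_of_ell_le hP hPV (N := n * (k + 1)) (Nat.mul_pos hn k.succ_pos) hr.le ?_
  calc _ ≤ _ := ell_le_norm_pow_opBV_sub hP hV hPV (n * (k + 1)) (hQ.clm_comp _)
    _ ≤ C * s ^ (n * (k + 1)) := hle (k + 1)
    _ ≤ C' * s ^ (n * (k + 1)) := by gcongr; exact le_max_left _ _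
    _ ≤ _ := hk'

theorem essSpectralRadius_opBV (hP : IsMarkov P)
    (hV : Tendsto (fun n => (V n : ℝ)) atTop atTop) (hPV : DriftBounded P V)
    (hL : bigL P V < 1) : essSpectralRadius (opBV P V hP hPV) = bigL P V := by
  have h0 := bigL_nonneg hP hPV
  have hmem : ∀ r, bigL P V < r → r < 1 →
      r ∈ {r₀ : ℝ | 0 < r₀ ∧ r₀ < 1 ∧ QCDecomposition (opBV P V hP hPV) r₀} := fun r h1 h2 =>
    ⟨h0.trans_lt h1, h2, qcDecomposition_of_bigL_lt hP hV hPV h1 h2⟩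
  refine le_antisymm ?_ ?_
  · by_contra! hlt
    obtain ⟨r, hr1, hr2⟩ := exists_between (lt_min hlt hL)
    have h1 : essSpectralRadius (opBV P V hP hPV) ≤ r :=
      csInf_le ⟨0, fun x hx => hx.1.le⟩ (hmem r hr1 (hr2.trans_le (min_le_right _ _)))
    exact absurd (hr2.trans_le (min_le_left _ _)) (not_lt.2 h1)
  · obtain ⟨r, hr1, hr2⟩ := exists_between hL
    exact le_csInf ⟨r, hmem r hr1 hr2⟩ fun x hx => bigL_le_of_qcDecomposition hP hV hPV hx.1 hx.2.2

end Lower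

end MarkovBV

end

theorem proposition3 (P : ℕ → ℕ → ℝ) (V : ℕ → Set.Ici (1 : ℝ))
    (hP : MarkovBV.IsMarkov P)
    (hV : Filter.Tendsto (fun n => (V n : ℝ)) Filter.atTop Filter.atTop)
    (hPV : MarkovBV.DriftBounded P V) :
    (MarkovBV.WeakDrift P V ↔ MarkovBV.bigL P V < 1) ∧
    (MarkovBV.WeakDrift P V →
      MarkovBV.PowerBounded (MarkovBV.opBV P V hP hPV) ∧
      MarkovBV.QuasiCompact (MarkovBV.opBV P V hP hPV) ∧
      MarkovBV.essSpectralRadius (MarkovBV.opBV P V hP hPV) = MarkovBV.deltaV P V ∧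
      MarkovBV.deltaV P V = MarkovBV.bigL P V) := by
  have hiff := MarkovBV.weakDrift_iff_bigL_lt_one hP hV hPV
  refine ⟨hiff, fun hW => ?_⟩
  have hL := hiff.1 hW
  have hδ := MarkovBV.deltaV_eq_bigL hP hV hPV hL
  obtain ⟨r, hr1, hr2⟩ := exists_between hL
  exact ⟨MarkovBV.powerBounded_opBV hP hPV hW,
    ⟨r, (MarkovBV.bigL_nonneg hP hPV).trans_lt hr1, hr2,
      MarkovBV.qcDecomposition_of_bigL_lt hP hV hPV hr1 hr2⟩,
    (MarkovBV.essSpectralRadius_opBV hP hV hPV hL).trans hδ.symm, hδ⟩
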